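/- All graphs are finite and simple; the order of a graph $G$ is its number of vertices and $e(G)$ is its number of edges. For a set $S$ of at least two vertices of $G$, let $\kappa(S)$ be the maximum number $\ell$ of pairwise edge-disjoint trees $T_1,\dots,T_\ell$ in $G$ such that $S\subseteq V(T_i)$ for every $i$ and $V(T_i)\cap V(T_j)=S$ for all $i\neq j$. For a graph $G$ of order at least $3$, the generalized $3$-connectivity $\kappa_3(G)$ is the minimum of $\kappa(S)$ over all $3$-element sets $S\subseteq V(G)$ (so $\kappa_3(G)=0$ if $G$ is disconnected). **Theorem 1.** (a) If $G$ is a graph of order $n$ with $\kappa_3(G)=2$, then $e(G)\ge\lceil \tfrac65 n\rceil$. (b) For every $n\ge 4$ with $n\ne 9,10$ there is a connected graph $G$ of order $n$ with $\kappa_3(G)=2$ and $e(G)=\lceil \tfrac65 n\rceil$. (c) For $n\in\{9,10\}$, every graph $G$ of order $n$ with $\kappa_3(G)=2$ satisfies $e(G)\ge\lceil \tfrac65 n\rceil+1$, and there is a connected graph $G$ of order $n$ with $\kappa_3(G)=2$ and $e(G)=\lceil \tfrac65 n\rceil+1$. -/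

import Mathlib

namespace GenConn

/-- `T 0, …, T (ℓ - 1)` are trees in `G` connecting `S`: each contains `S`, they are pairwise
edge-disjoint, and any two distinct ones have exactly the vertices of `S` in common. -/
structure IsTreeFamily {V : Type*} (G : SimpleGraph V) (S : Finset V) {ℓ : ℕ}
    (T : Fin ℓ → G.Subgraph) : Prop where
  isTree : ∀ i, (T i).coe.IsTree
  subset_verts : ∀ i, (S : Set V) ⊆ (T i).verts
  edge_disjoint : ∀ i j, i ≠ j → Disjoint (T i).edgeSet (T j).edgeSet
  verts_inter : ∀ i j, i ≠ j → (T i).verts ∩ (T j).verts = (S : Set V)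

/-- `κ(S)`: the maximum number of pairwise edge-disjoint trees of `G` that contain `S` and
pairwise meet exactly in `S`. In a finite graph with `2 ≤ |S|` the supremum is an attained,
finite maximum. -/
noncomputable def kappaSet {V : Type*} (G : SimpleGraph V) (S : Finset V) : ℕ∞ :=
  ⨆ ℓ ∈ {ℓ : ℕ | ∃ T : Fin ℓ → G.Subgraph, IsTreeFamily G S T}, (ℓ : ℕ∞)

/-- The generalized `k`-connectivity `κ_k(G)`: the minimum of `κ(S)` over all `k`-subsets `S` of
the vertex set (it is `⊤` if there is no `k`-subset). -/
noncomputable def genConnectivity {V : Type*} (k : ℕ) (G : SimpleGraph V) : ℕ∞ :=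
  ⨅ S ∈ {S : Finset V | S.card = k}, kappaSet G S

end GenConn

/-! Lower bound. Let D be the set of vertices of degree two. A vertex of D in a triple S gives
exactly one edge to each of two trees joining S. If two vertices of D in S were adjacent, the tree
through their common edge could not leave it; so D is independent (`not_adj_of_degree_two`) and 2|D|
≤ e. All degrees are at least two, so 3n - |D| ≤ 2e. Eliminating |D| gives 6n ≤ 5e.

Orders 9 and 10. If e ≤ ⌈6n/5⌉, these counts leave four cubic vertices, the hubs, and five or six
vertices of D, each subdividing an edge between hubs. For a triple of subdividing vertices, each hub
serves at most one of the two trees. This excludes subdivided triangles, and a subdivided path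
through all four hubs forces two edges between hubs (`adj_of_subdivided_path`), while at most one
exists. The remaining patterns have too few subdividing vertices (`not_isHubQuadruple`).

Constructions. Subdividing every edge of a cubic graph on 2k vertices gives 5k vertices and 6k
edges, which is equality. The Möbius ladder with k ≥ 3 rungs works (`doublyJoined_mobius`): k = 3 is
a finite check, and in a longer ladder some rung avoids the triple, can be rotated to the end, and
is absorbed by lengthening two edges of the shorter ladder. Suppressing j ≤ 4 subdividing vertices
reaches every n ≥ 11, since ⌈6(5k - j)/5⌉ = 6k - j. Smaller orders use explicit graphs checked by
computation (`doublyJoined_of_allJoined`). -/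

namespace GenConn

variable {V W : Type*}

/-! ### Two trees joining a triple, restated with arbitrary subgraphs. -/

/-- `G` contains two edge-disjoint subgraphs, meeting only in `S`, each of which has the vertices
of `S` in one connected component. -/
def DoublyJoined (G : SimpleGraph V) (S : Finset V) : Prop :=
  ∃ K L : SimpleGraph V, K ≤ G ∧ L ≤ G ∧ (∀ x y, K.Adj x y → ¬ L.Adj x y) ∧
    (∀ x y z, K.Adj x y → L.Adj x z → x ∈ S) ∧
    (∀ x ∈ S, ∀ y ∈ S, K.Reachable x y) ∧ (∀ x ∈ S, ∀ y ∈ S, L.Reachable x y)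

lemma reachable_of_map {H : SimpleGraph V} {K : SimpleGraph W} (φ : V → W)
    (h : ∀ x y, H.Adj x y → K.Reachable (φ x) (φ y)) {x y : V} (hxy : H.Reachable x y) :
    K.Reachable (φ x) (φ y) := by
  obtain ⟨p⟩ := hxy
  induction p with
  | nil => exact SimpleGraph.Reachable.refl _
  | cons hadj _ ih => exact (h _ _ hadj).trans ih

lemma mem_of_reachable {K : SimpleGraph V} {X : Set V}
    (hX : ∀ x ∈ X, ∀ y, K.Adj x y → y ∈ X) {x y : V} (hxy : K.Reachable x y) (hx : x ∈ X) :
    y ∈ X := by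
  obtain ⟨p⟩ := hxy
  induction p with
  | nil => exact hx
  | cons hadj _ ih => exact ih (hX _ hx _ hadj)

lemma exists_adj_of_reachable {K : SimpleGraph V} {x y : V} (h : K.Reachable x y) (hne : x ≠ y) :
    ∃ z, K.Adj x z := by
  obtain ⟨p⟩ := h
  cases p with
  | nil => exact absurd rfl hne
  | cons hadj _ => exact ⟨_, hadj⟩

/-- A spanning tree of the component of `s` in `K`, as a subgraph of any `G ≥ K`. -/
lemma exists_tree_subgraph [Finite V] {G K : SimpleGraph V} (hK : K ≤ G) (s : V) :
    ∃ T : G.Subgraph, T.coe.IsTree ∧ T.verts = {x | K.Reachable s x} ∧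
      ∀ x y, T.Adj x y → K.Adj x y := by
  set X : Set V := {x | K.Reachable s x} with hXdef
  have hconn : (K.induce X).Connected := by
    have : Nonempty X := ⟨⟨s, SimpleGraph.Reachable.refl _⟩⟩
    refine SimpleGraph.Connected.mk ?_
    have key : ∀ x y (_ : K.Walk x y) (hx : x ∈ X) (hy : y ∈ X),
        (K.induce X).Reachable ⟨x, hx⟩ ⟨y, hy⟩ := by
      intro x y p hx hy
      induction p with
      | nil => exact SimpleGraph.Reachable.refl _
      | cons hadj p ih =>
        refine SimpleGraph.Reachable.trans (SimpleGraph.Adj.reachable ?_)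
          (ih (SimpleGraph.Reachable.trans hx hadj.reachable) hy)
        simpa using hadj
    rintro ⟨x, hx⟩ ⟨y, hy⟩
    obtain ⟨p⟩ : K.Reachable x y := SimpleGraph.Reachable.trans (SimpleGraph.Reachable.symm hx) hy
    exact key x y p hx hy
  obtain ⟨T, hT, htree⟩ := hconn.exists_isTree_le
  refine ⟨{ verts := X
            Adj := fun x y => ∃ (hx : x ∈ X) (hy : y ∈ X), T.Adj ⟨x, hx⟩ ⟨y, hy⟩
            adj_sub := ?_, edge_vert := ?_, symm := ?_ }, ?_, rfl, ?_⟩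
  · rintro x y ⟨hx, hy, h⟩
    exact hK (by simpa using hT h)
  · rintro x y ⟨hx, _, _⟩
    exact hx
  · exact ⟨fun x y ⟨hx, hy, h⟩ => ⟨hy, hx, h.symm⟩⟩
  · convert htree using 1
    ext ⟨x, hx⟩ ⟨y, hy⟩
    simp only [SimpleGraph.Subgraph.coe_adj]
    exact ⟨fun ⟨_, _, h⟩ => h, fun h => ⟨hx, hy, h⟩⟩
  · rintro x y ⟨hx, hy, h⟩
    simpa using hT h

lemma IsTreeFamily.exists_adj {G : SimpleGraph V} {S : Finset V} {ℓ : ℕ}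
    {T : Fin ℓ → G.Subgraph} (hT : IsTreeFamily G S T) (hS : 2 ≤ S.card) {v : V} (hv : v ∈ S)
    (i : Fin ℓ) : ∃ y, (T i).Adj v y := by
  obtain ⟨w, hw, hne⟩ := Finset.exists_mem_ne (s := S) (by omega) v
  obtain ⟨⟨z, hz⟩, h⟩ := exists_adj_of_reachable
    ((hT.isTree i).connected.preconnected ⟨v, hT.subset_verts i hv⟩ ⟨w, hT.subset_verts i hw⟩)
    (by simpa using hne.symm)
  exact ⟨z, by simpa using h⟩

/-- Spanning trees of the components of `s` in `K` and `L` suffice: a vertex other than `s` in both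
trees has an edge of each graph, hence lies in `S`. -/
lemma DoublyJoined.two_le_kappaSet [Finite V] {G : SimpleGraph V} {S : Finset V}
    (hS : S.Nonempty) (h : DoublyJoined G S) : 2 ≤ kappaSet G S := by
  obtain ⟨K, L, hK, hL, hKL, hmeet, hKr, hLr⟩ := h
  obtain ⟨s, hs⟩ := hS
  obtain ⟨T, hTt, hTv, hTa⟩ := exists_tree_subgraph hK s
  obtain ⟨U, hUt, hUv, hUa⟩ := exists_tree_subgraph hL s
  have hST : (S : Set V) ⊆ T.verts := fun x hx => by rw [hTv]; exact hKr s hs x hx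
  have hSU : (S : Set V) ⊆ U.verts := fun x hx => by rw [hUv]; exact hLr s hs x hx
  have hdisj : Disjoint T.edgeSet U.edgeSet := by
    rw [Set.disjoint_left]
    intro e
    induction e with
    | _ x y =>
      exact fun h1 h2 => hKL x y (hTa _ _ (by simpa using h1)) (hUa _ _ (by simpa using h2))
  have hinter : T.verts ∩ U.verts = S := by
    refine Set.Subset.antisymm ?_ (Set.subset_inter hST hSU)
    rintro x ⟨h1, h2⟩
    rw [hTv] at h1
    rw [hUv] at h2
    by_cases hx : x = s
    · exact hx ▸ hs
    · obtain ⟨y, hy⟩ := exists_adj_of_reachable h1.symm hx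
      obtain ⟨z, hz⟩ := exists_adj_of_reachable h2.symm hx
      exact hmeet x y z hy hz
  refine le_iSup₂_of_le (f := fun (ℓ : ℕ) (_ : ℓ ∈ _) => (ℓ : ℕ∞)) 2
    ⟨![T, U], ?_, ?_, ?_, ?_⟩ (by simp)
  · simp [Fin.forall_fin_two, hTt, hUt]
  · simp only [Fin.forall_fin_two]
    exact ⟨hST, hSU⟩
  · simp [Fin.forall_fin_two, hdisj, hdisj.symm]
  · simp [Fin.forall_fin_two, hinter, Set.inter_comm U.verts]

lemma doublyJoined_of_two_le_kappaSet {G : SimpleGraph V} {S : Finset V}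
    (h : 2 ≤ kappaSet G S) : DoublyJoined G S := by
  obtain ⟨ℓ, ⟨T, hT⟩, hℓ⟩ : ∃ ℓ ∈ {ℓ : ℕ | ∃ T : Fin ℓ → G.Subgraph, IsTreeFamily G S T}, 2 ≤ ℓ := by
    by_contra! hcon
    have : kappaSet G S ≤ 1 := iSup₂_le fun ℓ hℓ => by
      exact_mod_cast Nat.le_of_lt_succ (hcon ℓ hℓ)
    exact absurd (h.trans this) (by decide)
  have hreach : ∀ i, ∀ x ∈ S, ∀ y ∈ S, (T i).spanningCoe.Reachable x y := by
    intro i x hx y hy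
    exact reachable_of_map (H := (T i).coe) Subtype.val
      (fun a b hab => SimpleGraph.Adj.reachable (by simpa using hab))
      ((hT.isTree i).connected.preconnected
        ⟨x, hT.subset_verts i hx⟩ ⟨y, hT.subset_verts i hy⟩)
  have hne : (⟨0, by omega⟩ : Fin ℓ) ≠ ⟨1, by omega⟩ := by simp
  refine ⟨(T ⟨0, by omega⟩).spanningCoe, (T ⟨1, by omega⟩).spanningCoe,
    SimpleGraph.Subgraph.spanningCoe_le _, SimpleGraph.Subgraph.spanningCoe_le _, ?_, ?_,
    hreach _, hreach _⟩
  · intro x y h1 h2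
    exact Set.disjoint_left.1 (hT.edge_disjoint _ _ hne)
      (show s(x, y) ∈ _ by simpa using h1) (by simpa using h2)
  · intro x y z h1 h2
    have := hT.verts_inter _ _ hne
    have hx : x ∈ (T ⟨0, by omega⟩).verts ∩ (T ⟨1, by omega⟩).verts :=
      ⟨(T _).edge_vert (by simpa using h1), (T _).edge_vert (by simpa using h2)⟩
    rw [this] at hx
    exact hx

lemma two_le_genConnectivity_iff [Finite V] {G : SimpleGraph V} :
    2 ≤ genConnectivity 3 G ↔ ∀ S : Finset V, S.card = 3 → DoublyJoined G S := by
  simp only [genConnectivity, le_iInf_iff, Set.mem_ofPred_eq]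
  refine forall₂_congr fun S hS => ⟨doublyJoined_of_two_le_kappaSet, fun h => ?_⟩
  exact h.two_le_kappaSet (Finset.card_pos.1 (by omega))

/-! ### Degrees, and the bound 6n ≤ 5e. -/

/-- Every tree of a family has an edge at `v`, because `S` has another vertex; edge-disjointness
makes the far ends of these edges distinct. -/
lemma kappaSet_le_degree {G : SimpleGraph V} {S : Finset V} (hS : 2 ≤ S.card) {v : V}
    (hv : v ∈ S) [Fintype (G.neighborSet v)] : kappaSet G S ≤ G.degree v := by
  refine iSup₂_le fun ℓ hℓ => ?_
  obtain ⟨T, hT⟩ := hℓ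
  choose f hf using hT.exists_adj hS hv
  have hinj : Function.Injective f := by
    intro i j hij
    by_contra hne
    exact Set.disjoint_left.1 (hT.edge_disjoint _ _ hne)
      (show s(v, f i) ∈ _ by simpa using hf i) (by simpa [hij] using hf j)
  have := Finset.card_le_card_of_injOn (s := Finset.univ) (t := G.neighborFinset v) f
    (fun i _ => by simpa using (hf i).adj_sub) hinj.injOn
  simpa using this

lemma three_le_card [Fintype V] {G : SimpleGraph V} (h : genConnectivity 3 G = 2) :
    3 ≤ Fintype.card V := by
  by_contra! hlt
  -- Without 3-subsets the infimum is over an empty family, so it is `⊤` and not 2.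
  have : genConnectivity 3 G = ⊤ := by
    simp only [genConnectivity, iInf_eq_top, Set.mem_ofPred_eq]
    intro S hS
    have := S.card_le_univ
    omega
  rw [this] at h
  exact absurd h (by decide)

/-- A graph with fewer than `3n/2` edges has a vertex of degree at most two. -/
lemma genConnectivity_le_two [Fintype V] {G : SimpleGraph V} (hcard : 3 ≤ Fintype.card V)
    (he : 2 * G.edgeSet.ncard < 3 * Fintype.card V) : genConnectivity 3 G ≤ 2 := by
  classical
  obtain ⟨v, hv⟩ : ∃ v, G.degree v ≤ 2 := by
    by_contra! hdeg
    have h1 := G.sum_degrees_eq_twice_card_edges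
    have h2 : ∑ _v : V, 3 ≤ ∑ v, G.degree v := Finset.sum_le_sum fun v _ => hdeg v
    have h3 : G.edgeSet.ncard = G.edgeFinset.card := by
      rw [← SimpleGraph.coe_edgeFinset, Set.ncard_coe_finset]
    simp at h2
    omega
  obtain ⟨S, hvS, -, hS⟩ := Finset.exists_subsuperset_card_eq (s := {v}) (t := Finset.univ) (n := 3)
    (by simp) (by simp) (by simpa using hcard)
  refine (iInf₂_le S hS).trans ((kappaSet_le_degree (v := v) (by omega) (hvS (by simp))).trans ?_)
  exact_mod_cast hv

lemma connected_of_doublyJoined [Fintype V] {G : SimpleGraph V} (hcard : 3 ≤ Fintype.card V)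
    (h : ∀ S : Finset V, S.card = 3 → DoublyJoined G S) : G.Connected := by
  classical
  have : Nonempty V := Fintype.card_pos_iff.1 (by omega)
  refine SimpleGraph.Connected.mk fun x y => ?_
  obtain ⟨S, hxyS, -, hS⟩ := Finset.exists_subsuperset_card_eq (s := {x, y}) (t := Finset.univ)
    (n := 3) (by simp) (Finset.card_le_two.trans (by simp)) (by simpa using hcard)
  obtain ⟨K, L, hK, -, -, -, hr, -⟩ := h S hS
  exact (hr x (hxyS (by simp)) y (hxyS (by simp))).mono hK

lemma two_le_degree [Fintype V] {G : SimpleGraph V} [DecidableRel G.Adj]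
    (hcard : 3 ≤ Fintype.card V)
    (h : ∀ S : Finset V, S.card = 3 → DoublyJoined G S) (v : V) : 2 ≤ G.degree v := by
  classical
  obtain ⟨S, hvS, -, hS⟩ := Finset.exists_subsuperset_card_eq (s := {v}) (t := Finset.univ) (n := 3)
    (by simp) (by simp) (by simpa using hcard)
  have := (h S hS).two_le_kappaSet (Finset.card_pos.1 (by omega))
  exact_mod_cast this.trans (kappaSet_le_degree (v := v) (by omega) (hvS (by simp)))

/-- The neighbours of a vertex of degree two are determined by any two of them. -/
lemma eq_or_eq_of_degree_two [Fintype V] {G : SimpleGraph V} [DecidableRel G.Adj]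
    {x p q r : V} (hx : G.degree x = 2) (hp : G.Adj x p) (hq : G.Adj x q) (hpq : p ≠ q)
    (hr : G.Adj x r) : r = p ∨ r = q := by
  classical
  have hsub : ({p, q} : Finset V) ⊆ G.neighborFinset x := by
    intro y hy
    simp only [Finset.mem_insert, Finset.mem_singleton] at hy
    rcases hy with rfl | rfl <;> simpa
  have heq := Finset.eq_of_subset_of_card_le hsub (by simp [hx, Finset.card_pair hpq])
  have : r ∈ G.neighborFinset x := by simpa
  rw [← heq] at this
  simpa using this

/-- At a vertex of degree two in `S` each of the two joining graphs uses exactly one edge. -/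
lemma unique_adj_of_degree_two [Fintype V] {G K L : SimpleGraph V} [DecidableRel G.Adj]
    {S : Finset V} (hS : 2 ≤ S.card) (hK : K ≤ G) (hL : L ≤ G)
    (hKL : ∀ x y, K.Adj x y → ¬ L.Adj x y) (hKr : ∀ x ∈ S, ∀ y ∈ S, K.Reachable x y)
    (hLr : ∀ x ∈ S, ∀ y ∈ S, L.Reachable x y) {x p q : V} (hxS : x ∈ S) (hx : G.degree x = 2)
    (hp : G.Adj x p) (hq : G.Adj x q) (hpq : p ≠ q) :
    (K.Adj x p ∧ L.Adj x q) ∨ (K.Adj x q ∧ L.Adj x p) := by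
  obtain ⟨w, hw, hne⟩ := Finset.exists_mem_ne (s := S) (by omega) x
  obtain ⟨y, hy⟩ := exists_adj_of_reachable (hKr x hxS w hw) hne.symm
  obtain ⟨z, hz⟩ := exists_adj_of_reachable (hLr x hxS w hw) hne.symm
  have hy' := eq_or_eq_of_degree_two hx hp hq hpq (hK hy)
  have hz' := eq_or_eq_of_degree_two hx hp hq hpq (hL hz)
  have := hKL x y hy
  grind

/-- The graph that contains the edge `xy` has no other edge at `x` or at `y`, so its component there
is `{x, y}` and it misses the third vertex of `S`. -/
lemma not_adj_of_degree_two [Fintype V] {G : SimpleGraph V} [DecidableRel G.Adj]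
    (hcard : 3 ≤ Fintype.card V) (h : ∀ S : Finset V, S.card = 3 → DoublyJoined G S) {x y : V}
    (hx : G.degree x = 2) (hy : G.degree y = 2) : ¬ G.Adj x y := by
  classical
  intro hxy
  obtain ⟨S, hxyS, -, hS⟩ := Finset.exists_subsuperset_card_eq (s := {x, y}) (t := Finset.univ)
    (n := 3) (by simp) (Finset.card_le_two.trans (by simp)) (by simpa using hcard)
  have hxS : x ∈ S := hxyS (by simp)
  have hyS : y ∈ S := hxyS (by simp)
  obtain ⟨z, hzS, hz⟩ : ∃ z ∈ S, z ∉ ({x, y} : Finset V) := by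
    by_contra! hcon
    have := (Finset.card_le_card (fun z hz => hcon z hz : S ⊆ {x, y})).trans Finset.card_le_two
    omega
  obtain ⟨K, L, hK, hL, hKL, -, hKr, hLr⟩ := h S hS
  obtain ⟨p, hp, hpy⟩ : ∃ p, G.Adj x p ∧ p ≠ y := by
    obtain ⟨p, hp, hne⟩ := Finset.exists_mem_ne (s := G.neighborFinset x) (by simp [hx]) y
    exact ⟨p, by simpa using hp, hne⟩
  obtain ⟨q, hq, hqx⟩ : ∃ q, G.Adj y q ∧ q ≠ x := by
    obtain ⟨q, hq, hne⟩ := Finset.exists_mem_ne (s := G.neighborFinset y) (by simp [hy]) x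
    exact ⟨q, by simpa using hq, hne⟩
  have isolated : ∀ K L : SimpleGraph V, K ≤ G → (∀ x y, K.Adj x y → ¬ L.Adj x y) →
      K.Reachable x z → K.Adj x y → L.Adj x p → L.Adj y q → False := by
    intro K L hK hKL hr hxyK hxp hyq
    have := mem_of_reachable (X := {x, y}) (fun a ha b hab => by
      have hb := hK hab
      have hb' : ¬ L.Adj a b := hKL a b hab
      rcases ha with rfl | rfl
      · rcases eq_or_eq_of_degree_two hx hxy hp hpy.symm hb with rfl | rfl
        · simp
        · exact absurd hxp hb'
      · rcases eq_or_eq_of_degree_two hy hxy.symm hq hqx.symm hb with rfl | rfl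
        · simp
        · exact absurd hyq hb') hr (by simp)
    exact hz (by simpa using this)
  have h1 := unique_adj_of_degree_two (by omega) hK hL hKL hKr hLr hxS hx hxy hp hpy.symm
  have h2 := unique_adj_of_degree_two (by omega) hK hL hKL hKr hLr hyS hy hxy.symm hq hqx.symm
  rcases h1 with ⟨h1, h1'⟩ | ⟨h1, h1'⟩
  · rcases h2 with ⟨h2, h2'⟩ | ⟨h2, h2'⟩
    · exact isolated K L hK hKL (hKr x hxS z hzS) h1 h1' h2'
    · exact hKL _ _ h1 h2'.symm
  · rcases h2 with ⟨h2, h2'⟩ | ⟨h2, h2'⟩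
    · exact hKL _ _ h2 h1'.symm
    · exact isolated L K hL (fun a b h h' => hKL a b h' h) (hLr x hxS z hzS) h1' h1 h2

/-- If the vertices of degree two are independent, then twice their number and the number of edges
that avoid them add up to at most the number of edges. -/
lemma two_mul_card_add_card_le [Fintype V] [DecidableEq V] {G : SimpleGraph V} [DecidableRel G.Adj]
    (hind : ∀ x y, G.degree x = 2 → G.degree y = 2 → ¬ G.Adj x y) (F : Finset (Sym2 V))
    (hF : F ⊆ G.edgeFinset) (hFD : ∀ e ∈ F, ∀ x ∈ e, G.degree x ≠ 2) :
    2 * (Finset.univ.filter fun x => G.degree x = 2).card + F.card ≤ G.edgeFinset.card := by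
  set D := Finset.univ.filter fun x => G.degree x = 2 with hD
  have hdeg : ∀ {x}, x ∈ D → G.degree x = 2 := fun hx => (Finset.mem_filter.1 hx).2
  have h1 : (D.biUnion fun x => G.incidenceFinset x).card = 2 * D.card := by
    rw [Finset.card_biUnion, Finset.sum_congr rfl
      (fun x hx => (G.card_incidenceFinset_eq_degree x).trans (hdeg hx))]
    · simp [mul_comm]
    · intro x hx y hy hxy
      refine Finset.disjoint_left.2 fun e hex hey => ?_
      rw [SimpleGraph.mem_incidenceFinset] at hex hey
      exact hind x y (hdeg hx) (hdeg hy) (G.adj_of_mem_incidenceSet hxy hex hey)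
  rw [← h1, ← Finset.card_union_of_disjoint]
  · refine Finset.card_le_card (Finset.union_subset ?_ hF)
    intro e he
    obtain ⟨x, -, hx⟩ := Finset.mem_biUnion.1 he
    exact G.incidenceFinset_subset x hx
  · rw [Finset.disjoint_left]
    intro e he heF
    obtain ⟨x, hxD, hx⟩ := Finset.mem_biUnion.1 he
    rw [SimpleGraph.mem_incidenceFinset] at hx
    exact hFD e heF x hx.2 (hdeg hxD)

/-- A vertex of degree two falls short of degree three by one, and no vertex falls short by more. -/
lemma three_mul_card_le [Fintype V] {G : SimpleGraph V} [DecidableRel G.Adj]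
    (hdeg : ∀ v, 2 ≤ G.degree v) :
    3 * Fintype.card V ≤
      2 * G.edgeFinset.card + (Finset.univ.filter fun x => G.degree x = 2).card := by
  rw [← G.sum_degrees_eq_twice_card_edges, Finset.card_filter, ← Finset.sum_add_distrib]
  have : ∑ _v : V, 3 ≤ ∑ v, (G.degree v + if G.degree v = 2 then 1 else 0) :=
    Finset.sum_le_sum fun v _ => by have := hdeg v; split_ifs <;> omega
  simpa [mul_comm] using this

lemma ncard_edgeSet_eq [Fintype V] [DecidableEq V] (G : SimpleGraph V) [DecidableRel G.Adj] :
    G.edgeSet.ncard = G.edgeFinset.card := by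
  rw [← SimpleGraph.coe_edgeFinset, Set.ncard_coe_finset]

lemma six_mul_card_le [Fintype V] {G : SimpleGraph V} (h : genConnectivity 3 G = 2) :
    6 * Fintype.card V ≤ 5 * G.edgeSet.ncard := by
  classical
  have hcard := three_le_card h
  have hG := two_le_genConnectivity_iff.1 h.ge
  have h1 := three_mul_card_le (two_le_degree hcard hG)
  have h2 := two_mul_card_add_card_le (fun x y hx hy => not_adj_of_degree_two hcard hG hx hy) ∅
    (by simp) (by simp)
  rw [ncard_edgeSet_eq]
  simp at h2
  omega

/-! ### Subdivided graphs on four hubs, and the orders 9 and 10. -/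

section FourHubs

variable [Fintype V] {G : SimpleGraph V} [DecidableRel G.Adj]

/-- Three vertices of degree two cannot subdivide the edges of a triangle. -/
lemma no_subdivided_triangle [DecidableEq V] (h : ∀ S : Finset V, S.card = 3 → DoublyJoined G S)
    {p q r x y z : V} (hpq : p ≠ q) (hqr : q ≠ r) (hrp : r ≠ p)
    (hp : G.degree p ≠ 2) (hq : G.degree q ≠ 2) (hr : G.degree r ≠ 2)
    (hx : G.degree x = 2) (hxp : G.Adj x p) (hxq : G.Adj x q)
    (hy : G.degree y = 2) (hyq : G.Adj y q) (hyr : G.Adj y r)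
    (hz : G.degree z = 2) (hzr : G.Adj z r) (hzp : G.Adj z p) : False := by
  have hxy : x ≠ y := by
    rintro rfl; have := eq_or_eq_of_degree_two hx hxp hxq hpq hyr; grind
  have hxz : x ≠ z := by
    rintro rfl; have := eq_or_eq_of_degree_two hx hxp hxq hpq hzr; grind
  have hyz : y ≠ z := by
    rintro rfl; have := eq_or_eq_of_degree_two hy hyq hyr hqr hzp; grind
  have hS : ({x, y, z} : Finset V).card = 3 := by
    rw [Finset.card_eq_three]; exact ⟨x, y, z, hxy, hxz, hyz, rfl⟩
  obtain ⟨K, L, hK, hL, hKL, hmeet, hKr, hLr⟩ := h _ hS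
  have hmeet' : ∀ v a b, G.degree v ≠ 2 → K.Adj a v → L.Adj b v → False := by
    intro v a b hv hav hbv
    have := hmeet v a b hav.symm hbv.symm
    simp only [Finset.mem_insert, Finset.mem_singleton] at this
    grind
  -- Each hub meets at most one of `K` and `L`, while the two ends of a subdivided edge meet
  -- different ones. This would be a proper 2-colouring of a triangle.
  have h1 := unique_adj_of_degree_two (by omega) hK hL hKL hKr hLr (by simp) hx hxp hxq hpq
  have h2 := unique_adj_of_degree_two (by omega) hK hL hKL hKr hLr (by simp) hy hyq hyr hqr
  have h3 := unique_adj_of_degree_two (by omega) hK hL hKL hKr hLr (by simp) hz hzr hzp hrp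
  have m1 := hmeet' p
  have m2 := hmeet' q
  have m3 := hmeet' r
  grind

/-- If `K` joins two hubs `a`, `c` and avoids the other hubs, then `a` and `c` are adjacent or have
a common neighbour of degree two. -/
lemma adj_or_common_of_reachable {K : SimpleGraph V} (hK : K ≤ G)
    (hind : ∀ x y, G.degree x = 2 → G.degree y = 2 → ¬ G.Adj x y) {a c : V} (hac : a ≠ c)
    (hc : G.degree c ≠ 2) (hhub : ∀ u v, G.degree v ≠ 2 → K.Adj u v → v = a ∨ v = c)
    (hr : K.Reachable a c) :
    G.Adj a c ∨ ∃ w, G.degree w = 2 ∧ G.Adj w a ∧ G.Adj w c := by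
  by_contra! hcon
  obtain ⟨hnadj, hncom⟩ := hcon
  -- If the conclusion fails, `K` cannot leave the set made of `a` and its neighbours of degree two.
  have := mem_of_reachable (X := {v | v = a ∨ (G.degree v = 2 ∧ G.Adj v a)}) (fun u hu v huv => by
    have hG := hK huv
    by_cases hv : G.degree v = 2
    · rcases hu with rfl | ⟨hu, hua⟩
      · exact Or.inr ⟨hv, hG.symm⟩
      · exact absurd hG (hind u v hu hv)
    · rcases hhub u v hv huv with rfl | rfl
      · exact Or.inl rfl
      · rcases hu with rfl | ⟨hu, hua⟩
        · exact absurd hG hnadj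
        · exact absurd hG (hncom u hu hua)) hr (Or.inl rfl)
  rcases this with h | ⟨h, -⟩
  · exact hac h.symm
  · exact hc h

variable (G) in
/-- The vertices of degree other than two are exactly the distinct vertices `a`, `b`, `c`, `d`. -/
structure IsHubQuadruple (a b c d : V) : Prop where
  degree_ne_two_iff : ∀ v, G.degree v ≠ 2 ↔ v = a ∨ v = b ∨ v = c ∨ v = d
  ab : a ≠ b
  ac : a ≠ c
  ad : a ≠ d
  bc : b ≠ c
  bd : b ≠ d
  cd : c ≠ d

namespace IsHubQuadruple

variable {a b c d : V}

/-- These transpositions generate all relabellings of the hubs. -/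
lemma swap_ab (H : IsHubQuadruple G a b c d) : IsHubQuadruple G b a c d :=
  ⟨fun v => (H.degree_ne_two_iff v).trans (by tauto), H.ab.symm, H.bc, H.bd, H.ac, H.ad, H.cd⟩

lemma swap_bc (H : IsHubQuadruple G a b c d) : IsHubQuadruple G a c b d :=
  ⟨fun v => (H.degree_ne_two_iff v).trans (by tauto), H.ac, H.ab, H.ad, H.bc.symm, H.cd, H.bd⟩

lemma swap_cd (H : IsHubQuadruple G a b c d) : IsHubQuadruple G a b d c :=
  ⟨fun v => (H.degree_ne_two_iff v).trans (by tauto), H.ab, H.ad, H.ac, H.bd, H.bc, H.cd.symm⟩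

lemma degree_ne_two (H : IsHubQuadruple G a b c d) :
    G.degree a ≠ 2 ∧ G.degree b ≠ 2 ∧ G.degree c ≠ 2 ∧ G.degree d ≠ 2 := by
  simp [H.degree_ne_two_iff]

end IsHubQuadruple

/-- Along the path the hubs belong alternately to the two joining graphs, so one graph joins `a` to
`c` avoiding `b` and `d`, and the other joins `b` to `d` avoiding `a` and `c`. Such a connection is
an edge or a subdivided edge, and the latter would close a subdivided triangle. -/
lemma adj_of_subdivided_path [DecidableEq V]
    (hind : ∀ x y, G.degree x = 2 → G.degree y = 2 → ¬ G.Adj x y)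
    (h : ∀ S : Finset V, S.card = 3 → DoublyJoined G S)
    {a b c d x y z : V} (H : IsHubQuadruple G a b c d)
    (hx : G.degree x = 2) (hxa : G.Adj x a) (hxb : G.Adj x b)
    (hy : G.degree y = 2) (hyb : G.Adj y b) (hyc : G.Adj y c)
    (hz : G.degree z = 2) (hzc : G.Adj z c) (hzd : G.Adj z d) : G.Adj a c ∧ G.Adj b d := by
  obtain ⟨hhubs, hab, hac, -, hbc, hbd, hcd⟩ := id H
  obtain ⟨ha, hb, hc, hd⟩ := H.degree_ne_two
  have hxy : x ≠ y := by
    rintro rfl; have := eq_or_eq_of_degree_two hx hxa hxb hab hyc; grind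
  have hxz : x ≠ z := by
    rintro rfl; have := eq_or_eq_of_degree_two hx hxa hxb hab hzc; grind
  have hyz : y ≠ z := by
    rintro rfl; have := eq_or_eq_of_degree_two hy hyb hyc hbc hzd; grind
  have hS : ({x, y, z} : Finset V).card = 3 := by
    rw [Finset.card_eq_three]; exact ⟨x, y, z, hxy, hxz, hyz, rfl⟩
  have key : ∀ K L : SimpleGraph V, K ≤ G → L ≤ G →
      (∀ u v w, G.degree v ≠ 2 → K.Adj u v → L.Adj w v → False) →
      K.Reachable x y → L.Reachable y z →
      K.Adj x a → L.Adj x b → K.Adj y c → L.Adj y b → K.Adj z c → L.Adj z d →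
      G.Adj a c ∧ G.Adj b d := by
    intro K L hK hL hm hKr hLr kxa lxb kyc lyb kzc lzd
    have h1 := adj_or_common_of_reachable hK hind hac hc (fun u v hv huv => by
      have := hm u v x hv huv
      have := hm u v z hv huv
      have := (hhubs v).1 hv
      grind) (kxa.symm.reachable.trans (hKr.trans kyc.reachable))
    have h2 := adj_or_common_of_reachable hL hind hbd hd (fun u v hv huv => by
      have := fun h => hm x v u hv h huv
      have := fun h => hm y v u hv h huv
      have := (hhubs v).1 hv
      grind) (lyb.symm.reachable.trans (hLr.trans lzd.reachable))
    constructor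
    · rcases h1 with h1 | ⟨w, hw, hwa, hwc⟩
      · exact h1
      · exact (no_subdivided_triangle h hab hbc hac.symm ha hb hc hx hxa hxb hy hyb hyc hw hwc
          hwa).elim
    · rcases h2 with h2 | ⟨w, hw, hwb, hwd⟩
      · exact h2
      · exact (no_subdivided_triangle h hbc hcd hbd.symm hb hc hd hy hyb hyc hz hzc hzd hw hwd
          hwb).elim
  obtain ⟨K, L, hK, hL, hKL, hmeet, hKr, hLr⟩ := h _ hS
  have hm : ∀ u v w, G.degree v ≠ 2 → K.Adj u v → L.Adj w v → False := by
    intro u v w hv huv hwv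
    have := hmeet v u w huv.symm hwv.symm
    simp only [Finset.mem_insert, Finset.mem_singleton] at this
    grind
  have h1 := unique_adj_of_degree_two (by omega) hK hL hKL hKr hLr (by simp) hx hxa hxb hab
  have h2 := unique_adj_of_degree_two (by omega) hK hL hKL hKr hLr (by simp) hy hyb hyc hbc
  have h3 := unique_adj_of_degree_two (by omega) hK hL hKL hKr hLr (by simp) hz hzc hzd hcd
  rcases h1 with ⟨h1, h1'⟩ | ⟨h1, h1'⟩
  · obtain ⟨h2, h2'⟩ : K.Adj y c ∧ L.Adj y b := h2.resolve_left fun h' => hm _ _ _ hb h'.1 h1'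
    obtain ⟨h3, h3'⟩ : K.Adj z c ∧ L.Adj z d := h3.resolve_right fun h' => hm _ _ _ hc h2 h'.2
    exact key K L hK hL hm (hKr _ (by simp) _ (by simp)) (hLr _ (by simp) _ (by simp))
      h1 h1' h2 h2' h3 h3'
  · obtain ⟨h2, h2'⟩ : K.Adj y b ∧ L.Adj y c := h2.resolve_right fun h' => hm _ _ _ hb h1 h'.2
    obtain ⟨h3, h3'⟩ : K.Adj z d ∧ L.Adj z c := h3.resolve_left fun h' => hm _ _ _ hc h'.1 h2'
    exact key L K hL hK (fun u v w hv h1 h2 => hm w v u hv h2 h1)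
      (hLr _ (by simp) _ (by simp)) (hKr _ (by simp) _ (by simp)) h1' h1 h2' h2 h3' h3

variable (G) in
/-- The common neighbours of `p` and `q` that have degree two. -/
def subdividers (p q : V) : Finset V :=
  Finset.univ.filter fun w => G.degree w = 2 ∧ G.Adj w p ∧ G.Adj w q

lemma mem_subdividers {p q w : V} :
    w ∈ subdividers G p q ↔ G.degree w = 2 ∧ G.Adj w p ∧ G.Adj w q := by
  simp [subdividers]

lemma subdividers_comm (p q : V) : subdividers G p q = subdividers G q p := by
  ext; simp only [mem_subdividers]; tauto

/-- Two vertices of degree three with three common neighbours of degree two form a component. -/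
lemma card_subdividers_lt_three [DecidableEq V]
    (h : ∀ S : Finset V, S.card = 3 → DoublyJoined G S) {p q r : V}
    (hpq : p ≠ q) (hr : G.degree r ≠ 2) (hrp : r ≠ p) (hrq : r ≠ q)
    (hp3 : G.degree p ≤ 3) (hq3 : G.degree q ≤ 3) : (subdividers G p q).card < 3 := by
  by_contra! hge
  have hS : ({p, q, r} : Finset V).card = 3 := by
    rw [Finset.card_eq_three]; exact ⟨p, q, r, hpq, hrp.symm, hrq.symm, rfl⟩
  obtain ⟨K, L, hK, hL, hKL, hmeet, hKr, hLr⟩ := h _ hS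
  -- The three common neighbours exhaust the neighbourhoods of `p` and `q`, so no edge leads on to
  -- `r`.
  have hp : subdividers G p q = G.neighborFinset p := Finset.eq_of_subset_of_card_le
    (fun w hw => by simpa using (mem_subdividers.1 hw).2.1.symm) (by simp; omega)
  have hq : subdividers G p q = G.neighborFinset q := Finset.eq_of_subset_of_card_le
    (fun w hw => by simpa using (mem_subdividers.1 hw).2.2.symm) (by simp; omega)
  have := mem_of_reachable (X := {v | v = p ∨ v = q ∨ v ∈ subdividers G p q}) (fun u hu v huv => by
    have hG := hK huv
    rcases hu with rfl | rfl | hu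
    · exact Or.inr (Or.inr (by rw [hp]; simpa using hG))
    · exact Or.inr (Or.inr (by rw [hq]; simpa using hG))
    · obtain ⟨h2, hup, huq⟩ := mem_subdividers.1 hu
      rcases eq_or_eq_of_degree_two h2 hup huq hpq hG with rfl | rfl
      · exact Or.inl rfl
      · exact Or.inr (Or.inl rfl)) (hKr p (by simp) r (by simp)) (Or.inl rfl)
  rcases this with h | h | h
  · exact hrp h
  · exact hrq h
  · exact hr (mem_subdividers.1 h).1

lemma sum_card_subdividers_le [DecidableEq V] {a b c d : V} (H : IsHubQuadruple G a b c d) :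
    (subdividers G a b).card + (subdividers G a c).card + (subdividers G a d).card
      ≤ G.degree a := by
  obtain ⟨-, hab, hac, had, hbc, hbd, hcd⟩ := H
  have hdisj : ∀ {p q : V}, a ≠ p → a ≠ q → p ≠ q →
      Disjoint (subdividers G a p) (subdividers G a q) := by
    intro p q hap haq hpq
    rw [Finset.disjoint_left]
    intro w h1 h2
    obtain ⟨hw, hwa, hwp⟩ := mem_subdividers.1 h1
    have := eq_or_eq_of_degree_two hw hwa hwp hap (mem_subdividers.1 h2).2.2
    grind
  rw [← Finset.card_union_of_disjoint (hdisj hab hac hbc), ← Finset.card_union_of_disjoint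
    (Finset.disjoint_union_left.2 ⟨hdisj hab had hbd, hdisj hac had hcd⟩),
    ← SimpleGraph.card_neighborFinset_eq_degree]
  refine Finset.card_le_card fun w hw => ?_
  simp only [Finset.mem_union, mem_subdividers, SimpleGraph.mem_neighborFinset] at hw ⊢
  rcases hw with (hw | hw) | hw <;> exact hw.2.1.symm

lemma card_degree_two_le [DecidableEq V]
    (hind : ∀ x y, G.degree x = 2 → G.degree y = 2 → ¬ G.Adj x y) {a b c d : V}
    (H : IsHubQuadruple G a b c d) :
    (Finset.univ.filter fun x => G.degree x = 2).card ≤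
      (subdividers G a b).card + (subdividers G a c).card + (subdividers G a d).card +
      (subdividers G b c).card + (subdividers G b d).card + (subdividers G c d).card := by
  have hsub : (Finset.univ.filter fun x => G.degree x = 2) ⊆
      subdividers G a b ∪ subdividers G a c ∪ subdividers G a d ∪ subdividers G b c ∪
        subdividers G b d ∪ subdividers G c d := by
    intro w hw
    replace hw := (Finset.mem_filter.1 hw).2
    obtain ⟨p, q, hpq, hN⟩ := Finset.card_eq_two.1 ((G.card_neighborFinset_eq_degree w).trans hw)
    have hp : G.Adj w p := by rw [← SimpleGraph.mem_neighborFinset, hN]; simp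
    have hq : G.Adj w q := by rw [← SimpleGraph.mem_neighborFinset, hN]; simp
    have hp' := (H.degree_ne_two_iff p).1 fun h => hind _ _ hw h hp
    have hq' := (H.degree_ne_two_iff q).1 fun h => hind _ _ hw h hq
    simp only [Finset.mem_union, mem_subdividers]
    grind
  refine (Finset.card_le_card hsub).trans ?_
  refine (Finset.card_union_le _ _).trans (Nat.add_le_add_right ?_ _)
  refine (Finset.card_union_le _ _).trans (Nat.add_le_add_right ?_ _)
  refine (Finset.card_union_le _ _).trans (Nat.add_le_add_right ?_ _)
  refine (Finset.card_union_le _ _).trans (Nat.add_le_add_right ?_ _)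
  exact Finset.card_union_le _ _

/-- No three subdivided edges form a path through four hubs, as that would force two more edges. -/
lemma no_subdivided_path [DecidableEq V]
    (hind : ∀ x y, G.degree x = 2 → G.degree y = 2 → ¬ G.Adj x y)
    (h : ∀ S : Finset V, S.card = 3 → DoublyJoined G S)
    (he : G.edgeFinset.card ≤ 2 * (Finset.univ.filter fun x => G.degree x = 2).card + 1)
    {a b c d : V} (H : IsHubQuadruple G a b c d) :
    (subdividers G a b).card = 0 ∨ (subdividers G b c).card = 0 ∨
      (subdividers G c d).card = 0 := by
  by_contra! hcon
  simp only [Finset.card_ne_zero] at hcon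
  obtain ⟨⟨x, hx⟩, ⟨y, hy⟩, ⟨z, hz⟩⟩ := hcon
  rw [mem_subdividers] at hx hy hz
  obtain ⟨h1, h2⟩ := adj_of_subdivided_path hind h H hx.1 hx.2.1
    hx.2.2 hy.1 hy.2.1 hy.2.2 hz.1 hz.2.1 hz.2.2
  -- Together with the edges at vertices of degree two, these two edges exceed the bound `he`.
  have := two_mul_card_add_card_le hind {s(a, c), s(b, d)}
    (by intro e
        simp only [Finset.mem_insert, Finset.mem_singleton]
        rintro (rfl | rfl) <;> simpa)
    (by intro e
        simp only [Finset.mem_insert, Finset.mem_singleton]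
        rintro (rfl | rfl) x hx <;> rw [H.degree_ne_two_iff] <;> rw [Sym2.mem_iff] at hx <;> tauto)
  rw [Finset.card_pair (by simp [H.ab, H.ad])] at this
  omega

/-- Two disjoint pairs of hubs cannot both be joined by subdivided edges. -/
lemma card_subdividers_eq_zero_or [DecidableEq V]
    (hind : ∀ x y, G.degree x = 2 → G.degree y = 2 → ¬ G.Adj x y)
    (h : ∀ S : Finset V, S.card = 3 → DoublyJoined G S) (hdeg : ∀ v, G.degree v ≤ 3)
    (hD : 5 ≤ (Finset.univ.filter fun x => G.degree x = 2).card)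
    (he : G.edgeFinset.card ≤ 2 * (Finset.univ.filter fun x => G.degree x = 2).card + 1)
    {a b c d : V} (H : IsHubQuadruple G a b c d) :
    (subdividers G a b).card = 0 ∨ (subdividers G c d).card = 0 := by
  have sum := card_degree_two_le hind H
  obtain ⟨ha, -, hc, -⟩ := H.degree_ne_two
  have l1 := card_subdividers_lt_three h H.ab hc H.ac.symm H.bc.symm (hdeg _) (hdeg _)
  have l2 := card_subdividers_lt_three h H.cd ha H.ac H.ad (hdeg _) (hdeg _)
  -- If both pairs were subdivided, these four paths would make the other four pairs empty, leaving
  -- at most 2 + 2 < 5 subdividing vertices.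
  have p1 := no_subdivided_path hind h he H
  have p2 := no_subdivided_path hind h he H.swap_ab
  have p3 := no_subdivided_path hind h he H.swap_cd
  have p4 := no_subdivided_path hind h he H.swap_ab.swap_cd
  rw [subdividers_comm b a] at p2 p4
  rw [subdividers_comm d c] at p3 p4
  omega

/-- At most one of any two opposite pairs of hubs is subdivided, so the subdivided pairs lie in a
star or in a triangle. Degree three allows at most 3 subdividing vertices on a star and at most 9/2
on a triangle, but there are at least 5. -/
lemma not_isHubQuadruple [DecidableEq V]
    (hind : ∀ x y, G.degree x = 2 → G.degree y = 2 → ¬ G.Adj x y)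
    (h : ∀ S : Finset V, S.card = 3 → DoublyJoined G S) (hdeg : ∀ v, G.degree v ≤ 3)
    (hD : 5 ≤ (Finset.univ.filter fun x => G.degree x = 2).card)
    (he : G.edgeFinset.card ≤ 2 * (Finset.univ.filter fun x => G.degree x = 2).card + 1)
    {a b c d : V} : ¬ IsHubQuadruple G a b c d := by
  intro H
  have sum := card_degree_two_le hind H
  have o1 := card_subdividers_eq_zero_or hind h hdeg hD he H
  have o2 := card_subdividers_eq_zero_or hind h hdeg hD he H.swap_bc
  have o3 := card_subdividers_eq_zero_or hind h hdeg hD he H.swap_cd.swap_bc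
  have da := (sum_card_subdividers_le H).trans (hdeg a)
  have db := (sum_card_subdividers_le H.swap_ab).trans (hdeg b)
  have dc := (sum_card_subdividers_le H.swap_bc.swap_ab).trans (hdeg c)
  have dd := (sum_card_subdividers_le H.swap_cd.swap_bc.swap_ab).trans (hdeg d)
  rw [subdividers_comm b a] at db
  rw [subdividers_comm c a, subdividers_comm c b] at dc
  rw [subdividers_comm d a, subdividers_comm d b, subdividers_comm d c] at dd
  omega

end FourHubs

lemma lt_ncard_edgeSet_of_card_eq_nine_or_ten [Fintype V] {G : SimpleGraph V}
    (hn : Fintype.card V = 9 ∨ Fintype.card V = 10) (h : genConnectivity 3 G = 2) :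
    (6 * Fintype.card V + 4) / 5 < G.edgeSet.ncard := by
  classical
  have hcard := three_le_card h
  have hG := two_le_genConnectivity_iff.1 h.ge
  have hind := fun x y hx hy => not_adj_of_degree_two (x := x) (y := y) hcard hG hx hy
  have hdeg2 := two_le_degree hcard hG
  have h1 := three_mul_card_le hdeg2
  have h2 := two_mul_card_add_card_le hind ∅ (by simp) (by simp)
  rw [ncard_edgeSet_eq]
  by_contra! hlt
  set D := Finset.univ.filter fun x => G.degree x = 2 with hD
  simp only [Finset.card_empty] at h2
  -- The two counts force |D| = 5, e = 11 for order 9 and |D| = 6, e = 12 for order 10.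
  have hC : Dᶜ.card = 4 := by rw [Finset.card_compl]; omega
  have hsum : ∑ v ∈ Dᶜ, G.degree v = 12 := by
    have h3 := G.sum_degrees_eq_twice_card_edges
    rw [← Finset.sum_add_sum_compl D, Finset.sum_congr rfl
      (fun x hx => (Finset.mem_filter.1 hx).2 : ∀ x ∈ D, G.degree x = 2)] at h3
    simp at h3
    omega
  have hdeg : ∀ v, G.degree v ≤ 3 := by
    intro v
    by_cases hv : v ∈ D
    · have := (Finset.mem_filter.1 hv).2
      omega
    · have hv' : v ∈ Dᶜ := by simpa using hv
      rw [← Finset.add_sum_erase _ _ hv'] at hsum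
      -- The other three hubs take at least 9 of the total 12.
      have : ∑ _w ∈ Dᶜ.erase v, 3 ≤ ∑ w ∈ Dᶜ.erase v, G.degree w :=
        Finset.sum_le_sum fun w hw => by
          have := hdeg2 w
          have hw' := (Finset.mem_erase.1 hw).2
          simp only [hD, Finset.mem_compl, Finset.mem_filter, Finset.mem_univ, true_and] at hw'
          omega
      rw [Finset.sum_const, Finset.card_erase_of_mem hv', hC] at this
      simp at this
      omega
  obtain ⟨a, ha⟩ : Dᶜ.Nonempty := Finset.card_pos.1 (by omega)
  obtain ⟨b, c, d, hbc, hbd, hcd, hE⟩ := Finset.card_eq_three.1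
    (show (Dᶜ.erase a).card = 3 by rw [Finset.card_erase_of_mem ha, hC])
  have hmem : ∀ v, v ∈ Dᶜ.erase a ↔ v = b ∨ v = c ∨ v = d := by simp [hE]
  have hmemD : ∀ v, v ∈ Dᶜ ↔ G.degree v ≠ 2 := by simp [hD]
  simp only [Finset.mem_erase, hmemD] at hmem ha
  have hdegree : ∀ v, G.degree v ≠ 2 ↔ v = a ∨ v = b ∨ v = c ∨ v = d := by
    intro v
    have := hmem v
    grind
  refine not_isHubQuadruple hind hG hdeg ?_ ?_
    ⟨hdegree, ?_, ?_, ?_, hbc, hbd, hcd⟩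
  · change 5 ≤ D.card
    omega
  · change _ ≤ 2 * D.card + 1
    omega
  all_goals grind

/-! ### Operations that preserve double joining. -/

/-- Injectivity matters only at ends of edges. This admits maps such as `Function.invFun f`, which
need not be injective off the vertex set in use. -/
lemma DoublyJoined.map {G : SimpleGraph V} {G' : SimpleGraph W} {S : Finset V} [DecidableEq W]
    (h : DoublyJoined G S) (g : V → W) (hadj : ∀ x y, G.Adj x y → G'.Adj (g x) (g y))
    (hinj : ∀ x y x' y', G.Adj x y → G.Adj x' y' → g x = g x' → x = x') :
    DoublyJoined G' (S.image g) := by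
  obtain ⟨K, L, hK, hL, hKL, hmeet, hKr, hLr⟩ := h
  let F : ∀ H : SimpleGraph V, H ≤ G → SimpleGraph W := fun H hH =>
    { Adj := fun a b => ∃ x y, H.Adj x y ∧ g x = a ∧ g y = b
      symm := ⟨fun a b ⟨x, y, h, hx, hy⟩ => ⟨y, x, h.symm, hy, hx⟩⟩
      loopless := ⟨fun a ⟨x, y, h, hx, hy⟩ => (hadj x y (hH h)).ne (hx.trans hy.symm)⟩ }
  have hr : ∀ (H : SimpleGraph V) (hH : H ≤ G), (∀ x ∈ S, ∀ y ∈ S, H.Reachable x y) →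
      ∀ x ∈ S.image g, ∀ y ∈ S.image g, (F H hH).Reachable x y := by
    intro H hH hS a ha b hb
    obtain ⟨x, hx, rfl⟩ := Finset.mem_image.1 ha
    obtain ⟨y, hy, rfl⟩ := Finset.mem_image.1 hb
    exact reachable_of_map g
      (fun u v huv => SimpleGraph.Adj.reachable (show (F H hH).Adj _ _ from ⟨u, v, huv, rfl, rfl⟩))
      (hS x hx y hy)
  have hle : ∀ (H : SimpleGraph V) (hH : H ≤ G), F H hH ≤ G' := by
    rintro H hH a b ⟨x, y, h, rfl, rfl⟩
    exact hadj x y (hH h)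
  refine ⟨F K hK, F L hL, hle K hK, hle L hL, ?_, ?_, hr K hK hKr, hr L hL hLr⟩
  · rintro a b ⟨x, y, h, rfl, rfl⟩ ⟨x', y', h', hx, hy⟩
    obtain rfl := hinj _ _ _ _ (hL h') (hK h) hx
    obtain rfl := hinj _ _ _ _ (hL h').symm (hK h).symm hy
    exact hKL _ _ h h'
  · rintro a b c ⟨x, y, h, rfl, rfl⟩ ⟨x', y', h', hx, hy⟩
    obtain rfl := hinj _ _ _ _ (hL h') (hK h) hx
    exact Finset.mem_image_of_mem _ (hmeet _ _ _ h h')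

/-- An edge `uv` may be replaced by a graph `P` that joins `u` to `v` and is otherwise new. -/
lemma DoublyJoined.replace_edge {G G' P : SimpleGraph V} {S : Finset V} {u v : V}
    (h : DoublyJoined G S) (hP : P.Reachable u v)
    (hPG : ∀ x y z, P.Adj x y → G.Adj x z → x = u ∨ x = v) (hPG' : P ≤ G')
    (hGG' : ∀ x y, G.Adj x y → s(x, y) ≠ s(u, v) → G'.Adj x y) : DoublyJoined G' S := by
  have key : ∀ K L : SimpleGraph V, K ≤ G → L ≤ G → (∀ x y, K.Adj x y → ¬ L.Adj x y) →
      (∀ x y z, K.Adj x y → L.Adj x z → x ∈ S) →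
      (∀ x ∈ S, ∀ y ∈ S, K.Reachable x y) → (∀ x ∈ S, ∀ y ∈ S, L.Reachable x y) →
      K.Adj u v → DoublyJoined G' S := by
    intro K L hK hL hKL hmeet hKr hLr huv
    have hLuv : ∀ x y, L.Adj x y → s(x, y) ≠ s(u, v) := by
      intro x y hxy heq
      rw [← SimpleGraph.mem_edgeSet, heq, SimpleGraph.mem_edgeSet] at hxy
      exact hKL _ _ huv hxy
    refine ⟨K.deleteEdges {s(u, v)} ⊔ P, L, ?_, ?_, ?_, ?_, ?_, hLr⟩
    · refine sup_le (fun x y hxy => ?_) hPG'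
      rw [SimpleGraph.deleteEdges_adj] at hxy
      exact hGG' x y (hK hxy.1) (by simpa using hxy.2)
    · exact fun x y hxy => hGG' x y (hL hxy) (hLuv x y hxy)
    · rintro x y (hxy | hxy) hL'
      · exact hKL x y (SimpleGraph.deleteEdges_adj.1 hxy).1 hL'
      -- A common edge of `P` and `L` would have both ends in `{u, v}`, so it would be `uv`, which
      -- belongs to `K`.
      · have hx := hPG x y y hxy (hL hL')
        have hy := hPG y x x hxy.symm (hL hL'.symm)
        have := hLuv x y hL'
        have := hL'.ne
        grind [Sym2.eq_iff]
    · rintro x y z (hxy | hxy) hL'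
      · exact hmeet x y z (SimpleGraph.deleteEdges_adj.1 hxy).1 hL'
      · rcases hPG x y z hxy (hL hL') with rfl | rfl
        · exact hmeet _ _ _ huv hL'
        · exact hmeet _ _ _ huv.symm hL'
    · intro x hx y hy
      refine reachable_of_map id (fun a b hab => ?_) (hKr x hx y hy)
      by_cases heq : s(a, b) = s(u, v)
      · rcases Sym2.eq_iff.1 heq with ⟨rfl, rfl⟩ | ⟨rfl, rfl⟩
        · exact hP.mono le_sup_right
        · exact hP.symm.mono le_sup_right
      · exact SimpleGraph.Adj.reachable
          (Or.inl (SimpleGraph.deleteEdges_adj.2 ⟨hab, by simpa using heq⟩))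
  obtain ⟨K, L, hK, hL, hKL, hmeet, hKr, hLr⟩ := h
  by_cases hKuv : K.Adj u v
  · exact key K L hK hL hKL hmeet hKr hLr hKuv
  by_cases hLuv : L.Adj u v
  · exact key L K hL hK (fun x y h h' => hKL x y h' h) (fun x y z h h' => hmeet x z y h' h) hLr hKr
      hLuv
  have hne : ∀ H : SimpleGraph V, ¬ H.Adj u v → ∀ x y, H.Adj x y → s(x, y) ≠ s(u, v) := by
    intro H hH x y hxy heq
    rw [← SimpleGraph.mem_edgeSet, heq] at hxy
    exact hH hxy
  exact ⟨K, L, fun x y hxy => hGG' x y (hK hxy) (hne K hKuv x y hxy),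
    fun x y hxy => hGG' x y (hL hxy) (hne L hLuv x y hxy), hKL, hmeet, hKr, hLr⟩

/-- Delete the vertex `w` and join `u` to `v`. -/
def suppress (G : SimpleGraph V) (u v w : V) : SimpleGraph V where
  Adj x y := x ≠ y ∧ ((G.Adj x y ∧ x ≠ w ∧ y ≠ w) ∨ s(x, y) = s(u, v))
  symm := ⟨fun x y ⟨h, h'⟩ => ⟨h.symm, by rw [Sym2.eq_swap, G.adj_comm]; tauto⟩⟩
  loopless := ⟨fun _ h => h.1 rfl⟩

lemma suppress_adj {G : SimpleGraph V} {u v w x y : V} : (suppress G u v w).Adj x y ↔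
    x ≠ y ∧ ((G.Adj x y ∧ x ≠ w ∧ y ≠ w) ∨ s(x, y) = s(u, v)) := Iff.rfl

/-- As `w` is outside `S`, at most one of the two graphs meets it. That graph receives the new edge
if it passes through `w`; the other is unchanged. -/
lemma DoublyJoined.suppress {G : SimpleGraph V} {S : Finset V} {u v w : V}
    (h : DoublyJoined G S) (hw : w ∉ S) (huv : u ≠ v) (hN : ∀ y, G.Adj w y → y = u ∨ y = v)
    (hnadj : ¬ G.Adj u v) : DoublyJoined (suppress G u v w) S := by
  have key : ∀ K L : SimpleGraph V, K ≤ G → L ≤ G → (∀ x y, K.Adj x y → ¬ L.Adj x y) →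
      (∀ x y z, K.Adj x y → L.Adj x z → x ∈ S) →
      (∀ x ∈ S, ∀ y ∈ S, K.Reachable x y) → (∀ x ∈ S, ∀ y ∈ S, L.Reachable x y) →
      (∀ y, ¬ L.Adj w y) → DoublyJoined (GenConn.suppress G u v w) S := by
    intro K L hK hL hKL hmeet hKr hLr hLw
    have hLne : ∀ x y, L.Adj x y → x ≠ w := by rintro x y hxy rfl; exact hLw _ hxy
    have hLuv : ∀ x y, L.Adj x y → s(x, y) ≠ s(u, v) := by
      intro x y hxy heq
      replace hxy := hL hxy
      rw [← SimpleGraph.mem_edgeSet, heq, SimpleGraph.mem_edgeSet] at hxy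
      exact hnadj hxy
    let K' : SimpleGraph V :=
      { Adj := fun x y => x ≠ y ∧ ((K.Adj x y ∧ x ≠ w ∧ y ≠ w) ∨
          (s(x, y) = s(u, v) ∧ K.Adj w u ∧ K.Adj w v))
        symm := ⟨fun x y ⟨h, h'⟩ => ⟨h.symm, by rw [Sym2.eq_swap, K.adj_comm]; tauto⟩⟩
        loopless := ⟨fun _ h => h.1 rfl⟩ }
    refine ⟨K', L, ?_, ?_, ?_, ?_, ?_, hLr⟩
    · rintro x y ⟨hne, h | h⟩
      · exact ⟨hne, Or.inl ⟨hK h.1, h.2⟩⟩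
      · exact ⟨hne, Or.inr h.1⟩
    · exact fun x y hxy => ⟨hxy.ne, Or.inl ⟨hL hxy, hLne _ _ hxy, hLne _ _ hxy.symm⟩⟩
    · rintro x y ⟨hne, h | h⟩ hL'
      · exact hKL x y h.1 hL'
      · exact hLuv x y hL' h.1
    · rintro x y z ⟨hne, h | ⟨h, hu, hv⟩⟩ hL'
      · exact hmeet x y z h.1 hL'
      · rcases Sym2.eq_iff.1 h with ⟨rfl, rfl⟩ | ⟨rfl, rfl⟩
        · exact hmeet _ _ _ hu.symm hL'
        · exact hmeet _ _ _ hv.symm hL'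
    · intro x hx y hy
      classical
      -- Contracting `w` into one of its neighbours turns walks of `K` into walks of `K'` and fixes
      -- `S`.
      let φ : V → V := fun z => if z = w then (if K.Adj w u then u else v) else z
      have hφ : ∀ z ∈ S, φ z = z := fun z hz => if_neg (by rintro rfl; exact hw hz)
      rw [← hφ x hx, ← hφ y hy]
      have hφw : ∀ z, K.Adj w z → K'.Reachable (φ w) z := by
        intro z hz
        have hφw : φ w = if K.Adj w u then u else v := if_pos rfl
        rw [hφw]
        split_ifs with hu
        · rcases hN z (hK hz) with rfl | rfl
          · exact SimpleGraph.Reachable.refl _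
          · exact SimpleGraph.Adj.reachable ⟨huv, Or.inr ⟨rfl, hu, hz⟩⟩
        · rcases hN z (hK hz) with rfl | rfl
          · exact absurd hz hu
          · exact SimpleGraph.Reachable.refl _
      refine reachable_of_map φ (fun a b hab => ?_) (hKr x hx y hy)
      by_cases ha : a = w
      · subst ha
        have hb : φ b = b := if_neg hab.ne'
        rw [hb]
        exact hφw b hab
      · have ha' : φ a = a := if_neg ha
        by_cases hb : b = w
        · subst hb
          rw [ha']
          exact (hφw a hab.symm).symm
        · have hb' : φ b = b := if_neg hb
          rw [ha', hb']
          exact SimpleGraph.Adj.reachable ⟨hab.ne, Or.inl ⟨hab, ha, hb⟩⟩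
  obtain ⟨K, L, hK, hL, hKL, hmeet, hKr, hLr⟩ := h
  by_cases hLw : ∀ y, ¬ L.Adj w y
  · exact key K L hK hL hKL hmeet hKr hLr hLw
  · push Not at hLw
    obtain ⟨y, hy⟩ := hLw
    exact key L K hL hK (fun x y h h' => hKL x y h' h) (fun x y z h h' => hmeet x z y h' h) hLr hKr
      (fun z hz => hw (hmeet w z y hz hy))

/-- `G` has its edges on the vertex set `A`, has `m` edges, and any three vertices of `A` are
doubly joined in it. -/
structure Realizes (G : SimpleGraph ℕ) (A : Finset ℕ) (m : ℕ) : Prop where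
  mem_of_adj : ∀ x y, G.Adj x y → x ∈ A
  ncard_edgeSet : G.edgeSet.ncard = m
  doublyJoined : ∀ S ⊆ A, S.card = 3 → DoublyJoined G S

lemma Realizes.suppress {G : SimpleGraph ℕ} {A : Finset ℕ} {m u v w : ℕ}
    (h : Realizes G A (m + 1)) (huv : u ≠ v)
    (hN : ∀ y, G.Adj w y ↔ y = u ∨ y = v) (hnadj : ¬ G.Adj u v) :
    Realizes (suppress G u v w) (A.erase w) m := by
  have hwu := (hN u).2 (Or.inl rfl)
  have hwv := (hN v).2 (Or.inr rfl)
  refine ⟨?_, ?_, ?_⟩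
  · rintro x y ⟨hne, hxy | hxy⟩
    · exact Finset.mem_erase.2 ⟨hxy.2.1, h.mem_of_adj _ _ hxy.1⟩
    · rcases Sym2.eq_iff.1 hxy with ⟨rfl, rfl⟩ | ⟨rfl, rfl⟩
      · exact Finset.mem_erase.2 ⟨hwu.ne', h.mem_of_adj _ _ hwu.symm⟩
      · exact Finset.mem_erase.2 ⟨hwv.ne', h.mem_of_adj _ _ hwv.symm⟩
  · have heq : (GenConn.suppress G u v w).edgeSet =
        insert s(u, v) (G.edgeSet \ {s(w, u), s(w, v)}) := by
      ext e
      induction e with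
      | _ x y =>
        rw [SimpleGraph.mem_edgeSet, suppress_adj]
        simp only [Set.mem_insert_iff, Set.mem_sdiff, SimpleGraph.mem_edgeSet, Set.mem_singleton_iff,
          Sym2.eq_iff]
        have h1 := hN x
        have h2 := hN y
        have h3 := @SimpleGraph.Adj.ne _ G x y
        have h4 := G.adj_comm x y
        grind
    -- An infinite set has `ncard` zero, so the positive count `m + 1` gives finiteness.
    have hfin : G.edgeSet.Finite := Set.finite_of_ncard_pos (by rw [h.ncard_edgeSet]; omega)
    rw [heq, Set.ncard_insert_of_notMem (by simp [hnadj]) hfin.sdiff, Set.ncard_sdiff _ (by simp),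
      Set.ncard_pair (by simp [huv, hwv.ne]), h.ncard_edgeSet]
    · have : ({s(w, u), s(w, v)} : Set (Sym2 ℕ)).ncard ≤ G.edgeSet.ncard :=
        Set.ncard_le_ncard (by rintro e (rfl | rfl) <;> simpa) hfin
      rw [Set.ncard_pair (by simp [huv, hwv.ne]), h.ncard_edgeSet] at this
      omega
    · rintro e (rfl | rfl) <;> simpa
  · intro S hS hcard
    refine (h.doublyJoined S (hS.trans (Finset.erase_subset _ _)) hcard).suppress
      (fun hw => ?_) huv (fun y hy => (hN y).1 hy) hnadj
    exact Finset.notMem_erase _ _ (hS hw)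

/-- The bound on `m` forces a vertex of degree at most two, hence κ₃ ≤ 2; the reverse inequality is
the double joining. -/
lemma Realizes.exists_graph {G : SimpleGraph ℕ} {A : Finset ℕ} {m n : ℕ} (h : Realizes G A m)
    (hA : A.card = n) (hn : 3 ≤ n) (hm : 2 * m < 3 * n) :
    ∃ G' : SimpleGraph (Fin n), G'.Connected ∧ genConnectivity 3 G' = 2 ∧ G'.edgeSet.ncard = m := by
  have : Nonempty (Fin n) := ⟨⟨0, by omega⟩⟩
  let f := A.orderEmbOfFin hA
  have hrange : ∀ x ∈ A, ∃ i, f i = x := by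
    intro x hx
    have : x ∈ Set.range f := by rw [Finset.range_orderEmbOfFin]; exact hx
    exact this
  have hfg : ∀ x ∈ A, f (Function.invFun f x) = x := fun x hx => Function.invFun_eq (hrange x hx)
  have hgf : ∀ i, Function.invFun f (f i) = i := Function.leftInverse_invFun f.injective
  have hcard : (G.comap f).edgeSet.ncard = m := by
    rw [← h.ncard_edgeSet, ← Set.ncard_image_of_injective _ (Sym2.map.injective f.injective)]
    congr 1
    ext e
    induction e with
    | _ x y =>
      constructor
      · rintro ⟨e, he, heq⟩
        induction e with
        | _ i j =>
          rw [← heq]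
          simpa using he
      · intro hxy
        have hx := h.mem_of_adj x y hxy
        have hy := h.mem_of_adj y x (SimpleGraph.Adj.symm hxy)
        obtain ⟨i, rfl⟩ := hrange x hx
        obtain ⟨j, rfl⟩ := hrange y hy
        exact ⟨s(i, j), by simpa using hxy, rfl⟩
  have hjoined : ∀ S : Finset (Fin n), S.card = 3 → DoublyJoined (G.comap f) S := by
    intro S hS
    have h1 := h.doublyJoined (S.map f.toEmbedding) (fun x hx => by
      obtain ⟨i, -, rfl⟩ := Finset.mem_map.1 hx
      exact Finset.orderEmbOfFin_mem A hA i) (by simpa using hS)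
    have h2 := h1.map (G' := G.comap f) (Function.invFun f) (fun x y hxy => by
      rw [SimpleGraph.comap_adj, hfg x (h.mem_of_adj x y hxy), hfg y (h.mem_of_adj y x hxy.symm)]
      exact hxy) (fun x y x' y' hxy hxy' heq => by
      rw [← hfg x (h.mem_of_adj x y hxy), heq, hfg x' (h.mem_of_adj x' y' hxy')])
    convert h2
    ext i
    simp [hgf]
  refine ⟨G.comap f, connected_of_doublyJoined (by simpa using hn) hjoined, le_antisymm ?_ ?_, hcard⟩
  · exact genConnectivity_le_two (by simpa using hn) (by rw [hcard]; simpa using hm)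
  · exact two_le_genConnectivity_iff.2 hjoined

/-! ### A computable test for double joining. -/

/-- Evaluate `f` at `n`, with `n` evaluated first. -/
def force {α : Type} (n : ℕ) (f : ℕ → α) : α := n.rec (f 0) (fun k _ => f (k + 1))

lemma force_eq {α : Type} (n : ℕ) (f : ℕ → α) : force n f = f n := by
  cases n <;> rfl

/-- Sets of natural numbers are represented by their bits. An edge is represented by its smaller
end and the pair of its ends. -/
def edgeCode (x y : ℕ) : ℕ × ℕ := (2 ^ min x y, 2 ^ x ||| 2 ^ y)

/-- The edge `e` has the colour whose vertices form the set `c`: its ends lie in `c` or in `S`, and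
if both lie in `S`, then the smaller one lies in `c`. Here `T` is the union of `c` and `S`. -/
def hasColour (c T S : ℕ) (e : ℕ × ℕ) : Bool :=
  (Nat.land e.2 T).beq e.2 && ((Nat.land e.1 c).beq e.1 || !(Nat.land e.2 S).beq e.2)

/-- Add the ends of `e` to `R` if `e` meets `R`. -/
def spread (R : ℕ) (e : ℕ × ℕ) : ℕ :=
  cond ((Nat.land R e.2).beq 0) R (Nat.lor R e.2)

/-- Following the edges in `F` for at most `n` rounds leads from `R` to all of `S`. -/
def spreadsTo (F : List (ℕ × ℕ)) (S : ℕ) : ℕ → ℕ → Bool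
  | 0, _ => false
  | n + 1, R => (Nat.land S R).beq S ||
      force (F.foldl spread R) fun R' => !R'.beq R && spreadsTo F S n R'

/-- The edges of colour `c` lead from `A` to all of `S`. -/
def joinsInColour (E : List (ℕ × ℕ)) (c S A : ℕ) : Bool :=
  force (Nat.lor c S) fun T => spreadsTo (E.filter (hasColour c T S)) S 8 A

/-- For all `a < b < c < n` one of the sets in `masks` is such that the colours given by it and by
its complement both join `a`, `b`, `c`. -/
def allJoined (E : List (ℕ × ℕ)) (n : ℕ) (masks : List ℕ) : Bool :=
  (List.range n).all fun c => (List.range c).all fun b => (List.range b).all fun a =>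
    force (2 ^ a) fun A => force (2 ^ a ||| 2 ^ b ||| 2 ^ c) fun S => masks.any fun m =>
      joinsInColour E m S A && force ((2 ^ n - 1) ^^^ m) fun m' => joinsInColour E m' S A

lemma two_pow_land_eq_iff (x c : ℕ) : Nat.land (2 ^ x) c = 2 ^ x ↔ c.testBit x = true := by
  change 2 ^ x &&& c = 2 ^ x ↔ _
  constructor
  · intro h
    have := congrArg (Nat.testBit · x) h
    simpa using this
  · intro h
    refine Nat.eq_of_testBit_eq fun i => ?_
    by_cases hi : x = i
    · subst hi; simp [h]
    · simp [hi]

lemma pair_land_eq_iff (x y c : ℕ) : Nat.land (2 ^ x ||| 2 ^ y) c = 2 ^ x ||| 2 ^ y ↔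
    c.testBit x = true ∧ c.testBit y = true := by
  rw [← two_pow_land_eq_iff, ← two_pow_land_eq_iff]
  change (2 ^ x ||| 2 ^ y) &&& c = 2 ^ x ||| 2 ^ y ↔ 2 ^ x &&& c = 2 ^ x ∧ 2 ^ y &&& c = 2 ^ y
  constructor
  · intro h
    constructor
    · rw [Nat.eq_iff_testBit_eq] at *
      intro i
      have := h i
      simp only [Nat.testBit_and, Nat.testBit_or] at *
      grind
    · rw [Nat.eq_iff_testBit_eq] at *
      intro i
      have := h i
      simp only [Nat.testBit_and, Nat.testBit_or] at *
      grind
  · rintro ⟨h1, h2⟩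
    rw [Nat.and_comm, Nat.and_or_distrib_left, Nat.and_comm, h1, Nat.and_comm, h2]

lemma hasColour_edgeCode (c S x y : ℕ) :
    hasColour c (Nat.lor c S) S (edgeCode x y) = true ↔
      (c.testBit x = true ∨ S.testBit x = true) ∧ (c.testBit y = true ∨ S.testBit y = true) ∧
      (c.testBit (min x y) = true ∨ ¬ (S.testBit x = true ∧ S.testBit y = true)) := by
  have h : Nat.lor c S = c ||| S := rfl
  simp only [hasColour, edgeCode, Bool.and_eq_true, Bool.or_eq_true, Bool.not_eq_true',
    Nat.beq_eq, ← Bool.not_eq_true, pair_land_eq_iff, two_pow_land_eq_iff, h, Nat.testBit_or]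
  tauto

/-- An end outside `S` would lie in both `c` and `c'`; if both ends are in `S`, the smaller one
would. -/
lemma hasColour_disjoint {c c' S x y : ℕ} (hx : c.testBit x = true → c'.testBit x = true → False)
    (hy : c.testBit y = true → c'.testBit y = true → False)
    (h : hasColour c (Nat.lor c S) S (edgeCode x y) = true)
    (h' : hasColour c' (Nat.lor c' S) S (edgeCode x y) = true) : False := by
  rw [hasColour_edgeCode] at h h'
  rcases min_choice x y with hm | hm <;> rw [hm] at h h' <;> tauto

lemma testBit_of_hasColour {c c' S x y z : ℕ}
    (hx : c.testBit x = true → c'.testBit x = true → False)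
    (h : hasColour c (Nat.lor c S) S (edgeCode x y) = true)
    (h' : hasColour c' (Nat.lor c' S) S (edgeCode x z) = true) : S.testBit x = true := by
  rw [hasColour_edgeCode] at h h'
  tauto

lemma reachable_of_testBit_foldl_spread {K : SimpleGraph ℕ} {a R : ℕ} {F : List (ℕ × ℕ)}
    (hF : ∀ e ∈ F, ∃ x y, e = edgeCode x y ∧ K.Adj x y)
    (hR : ∀ i, R.testBit i = true → K.Reachable a i) (i : ℕ)
    (hi : (F.foldl spread R).testBit i = true) : K.Reachable a i := by
  induction F generalizing R with
  | nil => exact hR i hi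
  | cons e F ih =>
    refine ih (fun e' he' => hF e' (by simp [he'])) (fun j hj => ?_) hi
    obtain ⟨x, y, rfl, hxy⟩ := hF e (by simp)
    cases hb : (Nat.land R (edgeCode x y).2).beq 0 with
    | true =>
      rw [spread, hb] at hj
      exact hR j hj
    | false =>
      rw [spread, hb] at hj
      have hne : R.testBit x = true ∨ R.testBit y = true := by
        by_contra! hcon
        have : Nat.land R (edgeCode x y).2 = 0 := by
          change R &&& (2 ^ x ||| 2 ^ y) = 0
          refine Nat.eq_of_testBit_eq fun i => ?_
          simp only [Nat.testBit_and, Nat.testBit_or, Nat.testBit_two_pow, Nat.zero_testBit]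
          grind
        rw [this] at hb
        exact absurd hb (by decide)
      have hboth : K.Reachable a x ∧ K.Reachable a y := by
        rcases hne with h | h
        · exact ⟨hR _ h, (hR _ h).trans hxy.reachable⟩
        · exact ⟨(hR _ h).trans hxy.symm.reachable, hR _ h⟩
      replace hj : (R ||| (2 ^ x ||| 2 ^ y)).testBit j = true := hj
      simp only [Nat.testBit_or, Nat.testBit_two_pow, Bool.or_eq_true, decide_eq_true_eq] at hj
      rcases hj with h | rfl | rfl
      · exact hR _ h
      · exact hboth.1
      · exact hboth.2

/-- Running out of rounds yields `false`, so the number of rounds cannot affect soundness. -/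
lemma reachable_of_spreadsTo {K : SimpleGraph ℕ} {a S n R : ℕ} {F : List (ℕ × ℕ)}
    (hF : ∀ e ∈ F, ∃ x y, e = edgeCode x y ∧ K.Adj x y)
    (hR : ∀ i, R.testBit i = true → K.Reachable a i) (h : spreadsTo F S n R = true) (i : ℕ)
    (hi : S.testBit i = true) : K.Reachable a i := by
  induction n generalizing R with
  | zero => simp [spreadsTo] at h
  | succ n ih =>
    simp only [spreadsTo, force_eq, Bool.or_eq_true, Bool.and_eq_true, Nat.beq_eq] at h
    rcases h with h | h
    · rw [← h] at hi
      replace hi : (S &&& R).testBit i = true := hi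
      rw [Nat.testBit_and, Bool.and_eq_true] at hi
      exact hR i hi.2
    · exact ih (reachable_of_testBit_foldl_spread hF hR) h.2

lemma reachable_of_joinsInColour {K : SimpleGraph ℕ} {E : List (ℕ × ℕ)} {a c S : ℕ}
    (hE : ∀ e ∈ E, hasColour c (Nat.lor c S) S e = true → ∃ x y, e = edgeCode x y ∧ K.Adj x y)
    (h : joinsInColour E c S (2 ^ a) = true) (i : ℕ) (hi : S.testBit i = true) :
    K.Reachable a i := by
  rw [joinsInColour, force_eq] at h
  refine reachable_of_spreadsTo (fun e he => ?_) (fun i hi => ?_) h i hi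
  · rw [List.mem_filter] at he
    exact hE e he.1 he.2
  · rw [Nat.testBit_two_pow, decide_eq_true_eq] at hi
    rw [hi]

lemma exists_lt_lt_of_card_eq_three {S : Finset ℕ} (hcard : S.card = 3) :
    ∃ a b c : ℕ, a < b ∧ b < c ∧ S = {a, b, c} := by
  let f := S.orderEmbOfFin hcard
  refine ⟨f 0, f 1, f 2, f.strictMono (by decide), f.strictMono (by decide), ?_⟩
  have hf : ∀ x, x ∈ S ↔ ∃ i, f i = x := fun x => by
    rw [← Set.mem_range, Finset.range_orderEmbOfFin, Finset.mem_coe]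
  ext x
  simp [hf, Fin.exists_fin_succ, eq_comm]

/-- A mask and its complement below `n` colour the vertices; those of `S` are open to both colours,
and an edge inside `S` takes the colour of its smaller end. The two colour classes of edges are
disjoint and meet only in `S`. -/
lemma doublyJoined_of_allJoined {E : List (ℕ × ℕ)} {n : ℕ} {masks : List ℕ}
    (h : allJoined (E.map fun e => edgeCode e.1 e.2) n masks = true) {G : SimpleGraph ℕ}
    (hn : ∀ x y, G.Adj x y → x < n)
    (hE : ∀ e ∈ E, G.Adj e.1 e.2) {S : Finset ℕ} (hS : S ⊆ Finset.range n) (hcard : S.card = 3) :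
    DoublyJoined G S := by
  obtain ⟨a, b, c, hab, hbc, rfl⟩ := exists_lt_lt_of_card_eq_three hcard
  have hc : c < n := by simpa using hS (by simp : c ∈ _)
  simp only [allJoined, force_eq, List.all_eq_true, List.mem_range, List.any_eq_true,
    Bool.and_eq_true] at h
  obtain ⟨m, -, ht, hf⟩ := h c hc b hbc a hab
  set s := 2 ^ a ||| 2 ^ b ||| 2 ^ c with hs
  have hmem : ∀ x, x ∈ ({a, b, c} : Finset ℕ) ↔ s.testBit x = true := by
    intro x
    simp only [hs, Nat.testBit_or, Nat.testBit_two_pow, Bool.or_eq_true, decide_eq_true_eq,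
      Finset.mem_insert, Finset.mem_singleton]
    grind
  set m' := (2 ^ n - 1) ^^^ m with hm'
  have hcompl : ∀ x, x < n → m.testBit x = true → m'.testBit x = true → False := by
    intro x hx h1 h2
    simp [hm', Nat.testBit_xor, Nat.testBit_two_pow_sub_one, hx, h1] at h2
  let K : ℕ → SimpleGraph ℕ := fun c =>
    { Adj := fun x y => G.Adj x y ∧ hasColour c (Nat.lor c s) s (edgeCode x y) = true
      symm := ⟨fun x y h => ⟨h.1.symm, by
        rw [edgeCode, min_comm, Nat.lor_comm]
        exact h.2⟩⟩
      loopless := ⟨fun x h => h.1.ne rfl⟩ }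
  have hr : ∀ c', joinsInColour (E.map fun e => edgeCode e.1 e.2) c' s (2 ^ a) = true →
      ∀ x ∈ ({a, b, c} : Finset ℕ), ∀ y ∈ ({a, b, c} : Finset ℕ), (K c').Reachable x y := by
    intro c' hc' x hx y hy
    have key := reachable_of_joinsInColour (K := K c') (fun e he h => by
      obtain ⟨p, hp, rfl⟩ := List.mem_map.1 he
      exact ⟨p.1, p.2, rfl, hE p hp, h⟩) hc'
    exact (key x ((hmem x).1 hx)).symm.trans (key y ((hmem y).1 hy))
  refine ⟨K m, K m', fun x y h => h.1, fun x y h => h.1, fun x y h h' => ?_,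
    fun x y z h h' => ?_, hr _ ht, hr _ hf⟩
  · exact hasColour_disjoint (hcompl x (hn x y h.1)) (hcompl y (hn y x h.1.symm)) h.2 h'.2
  · rw [hmem]
    exact testBit_of_hasColour (hcompl x (hn x y h.1)) h.2 h'.2

/-! ### The subdivided Möbius ladder. -/

/-- In the subdivided Möbius ladder with `k` rungs, on the vertices below `5 * k`, rung `j` joins
`5 * j` and `5 * j + 1` through `5 * j + 2`, and these two vertices are joined to those of the
next rung, with a twist after the last one, through `5 * j + 3` and `5 * j + 4`. Here `x` is a
subdividing vertex adjacent to `y`. -/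
def MobiusRel (k x y : ℕ) : Prop :=
  x < 5 * k ∧ ((x % 5 = 2 ∧ (y + 2 = x ∨ y + 1 = x)) ∨
    (3 ≤ x % 5 ∧ (y + 3 = x ∨ (x + 2 < 5 * k ∧ y = x + 2) ∨ (5 * k ≤ x + 2 ∧ x + y + 1 = 5 * k))))

/-- The subdivided Möbius ladder with `k` rungs, as a graph on `ℕ`. -/
def mobius (k : ℕ) : SimpleGraph ℕ where
  Adj x y := MobiusRel k x y ∨ MobiusRel k y x
  symm := ⟨fun _ _ => Or.symm⟩
  loopless := ⟨fun x h => by unfold MobiusRel at h; omega⟩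

lemma mobius_adj {k x y : ℕ} : (mobius k).Adj x y ↔ MobiusRel k x y ∨ MobiusRel k y x := Iff.rfl

lemma lt_of_mobius_adj {k x y : ℕ} (h : (mobius k).Adj x y) : x < 5 * k := by
  rw [mobius_adj] at h
  unfold MobiusRel at h
  omega

lemma ncard_edgeSet_mobius (k : ℕ) : (mobius k).edgeSet.ncard = 6 * k := by
  -- The two neighbours (`b = 0, 1`) of the subdividing vertex `5 * j + 2 + t`; the value `2 - t` is
  -- the twist after the last rung.
  let hub : ℕ → ℕ → ℕ → ℕ := fun j t b =>
    if t = 0 then 5 * j + b else if b = 0 then 5 * j + t - 1 else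
      if j + 1 < k then 5 * j + t + 4 else 2 - t
  have hR : ∀ j t b, j < k → t < 3 → b < 2 → MobiusRel k (5 * j + 2 + t) (hub j t b) := by
    intro j t b hj ht hb
    simp only [MobiusRel, hub]
    split_ifs <;> omega
  -- Residues modulo 5 tell subdividing vertices from hubs, so no edge is counted from both ends.
  have hcl : ∀ x y, MobiusRel k x y → 2 ≤ x % 5 ∧ y % 5 < 2 := by
    intro x y h
    unfold MobiusRel at h
    omega
  have heq : (mobius k).edgeSet =
      (fun p : ℕ × ℕ × ℕ => s(5 * p.1 + 2 + p.2.1, hub p.1 p.2.1 p.2.2)) ''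
        (Finset.range k ×ˢ Finset.range 3 ×ˢ Finset.range 2 : Finset (ℕ × ℕ × ℕ)) := by
    have key : ∀ x y, MobiusRel k x y → ∃ j t b, j < k ∧ t < 3 ∧ b < 2 ∧
        5 * j + 2 + t = x ∧ hub j t b = y := by
      intro x y h
      unfold MobiusRel at h
      by_cases hb : (x % 5 = 2 ∧ y + 2 = x) ∨ (3 ≤ x % 5 ∧ y + 3 = x)
      · refine ⟨x / 5, x % 5 - 2, 0, by omega, by omega, by omega, by omega, ?_⟩
        simp only [hub, if_true]
        split_ifs <;> omega
      · refine ⟨x / 5, x % 5 - 2, 1, by omega, by omega, by omega, by omega, ?_⟩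
        simp only [hub, one_ne_zero, if_false]
        split_ifs <;> omega
    ext e
    induction e with
    | _ x y =>
      simp only [SimpleGraph.mem_edgeSet, mobius_adj, Set.mem_image, Finset.mem_coe,
        Finset.mem_product, Finset.mem_range, Prod.exists]
      constructor
      · rintro (h | h)
        · obtain ⟨j, t, b, hj, ht, hb, rfl, rfl⟩ := key _ _ h
          exact ⟨j, t, b, ⟨hj, ht, hb⟩, rfl⟩
        · obtain ⟨j, t, b, hj, ht, hb, rfl, rfl⟩ := key _ _ h
          exact ⟨j, t, b, ⟨hj, ht, hb⟩, Sym2.eq_swap⟩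
      · rintro ⟨j, t, b, ⟨hj, ht, hb⟩, he⟩
        have := hR j t b hj ht hb
        rcases Sym2.eq_iff.1 he with ⟨rfl, rfl⟩ | ⟨rfl, rfl⟩
        · exact Or.inl this
        · exact Or.inr this
  rw [heq, Set.InjOn.ncard_image, Set.ncard_coe_finset]
  · simp; ring
  · rintro ⟨j, t, b⟩ h ⟨j', t', b'⟩ h' he
    simp only [Finset.mem_coe, Finset.mem_product, Finset.mem_range] at h h'
    obtain ⟨hj, ht, hb⟩ := h
    obtain ⟨hj', ht', hb'⟩ := h'
    have h1 := hcl _ _ (hR j t b hj ht hb)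
    have h2 := hcl _ _ (hR j' t' b' hj' ht' hb')
    rcases Sym2.eq_iff.1 he with ⟨h3, h4⟩ | ⟨h3, h4⟩
    · dsimp only at h3 h4
      obtain rfl : j = j' := by omega
      obtain rfl : t = t' := by omega
      have : b = b' := by
        simp only [hub] at h4
        split_ifs at h4 <;> omega
      rw [this]
    · dsimp only at h3 h4
      omega

lemma MobiusRel.succ {k x y : ℕ} (h : MobiusRel k x y) (h1 : ¬ (x + 2 = 5 * k ∧ y = 1))
    (h2 : ¬ (x + 1 = 5 * k ∧ y = 0)) : MobiusRel (k + 1) x y := by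
  obtain ⟨hx, ⟨h, h'⟩ | ⟨h, h' | h' | h'⟩⟩ := h
  · exact ⟨by omega, Or.inl ⟨h, h'⟩⟩
  · exact ⟨by omega, Or.inr ⟨h, Or.inl h'⟩⟩
  · exact ⟨by omega, Or.inr ⟨h, Or.inr (Or.inl (by omega))⟩⟩
  · omega

/-- Lengthening the ladder by one rung keeps the old vertices doubly joined. -/
lemma DoublyJoined.mobius_succ {k : ℕ} (hk : 1 ≤ k) {S : Finset ℕ}
    (h : DoublyJoined (mobius k) S) : DoublyJoined (mobius (k + 1)) S := by
  let P : ℕ → SimpleGraph ℕ := fun i => SimpleGraph.fromEdgeSet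
    {s(5 * k - 2 + i, 5 * k + i), s(5 * k + i, 5 * k + 3 + i), s(5 * k + 3 + i, 1 - i)}
  have hP : ∀ i x y, (P i).Adj x y ↔ ((x = 5 * k - 2 + i ∧ y = 5 * k + i ∨
      x = 5 * k + i ∧ y = 5 * k - 2 + i) ∨ (x = 5 * k + i ∧ y = 5 * k + 3 + i ∨
      x = 5 * k + 3 + i ∧ y = 5 * k + i) ∨ (x = 5 * k + 3 + i ∧ y = 1 - i ∨
      x = 1 - i ∧ y = 5 * k + 3 + i)) ∧ x ≠ y := by
    intro i x y
    simp only [P, SimpleGraph.fromEdgeSet_adj, Set.mem_insert_iff, Set.mem_singleton_iff,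
      Sym2.eq_iff]
  have hPr : ∀ i ≤ 1, (P i).Reachable (5 * k - 2 + i) (1 - i) := by
    intro i hi
    have h1 : (P i).Adj (5 * k - 2 + i) (5 * k + i) := (hP _ _ _).2 (by omega)
    have h2 : (P i).Adj (5 * k + i) (5 * k + 3 + i) := (hP _ _ _).2 (by omega)
    have h3 : (P i).Adj (5 * k + 3 + i) (1 - i) := (hP _ _ _).2 (by omega)
    exact h1.reachable.trans (h2.reachable.trans h3.reachable)
  -- The two edges that close the ladder are lengthened one at a time, through the ends of the new
  -- rung; its middle `5 * k + 2` stays unused.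
  have h1 : DoublyJoined ((mobius k).deleteEdges {s(5 * k - 2, 1)} ⊔ P 0) S := by
    refine h.replace_edge (hPr 0 (by omega)) (fun x y z hxy hxz => ?_) le_sup_right
      (fun x y hxy hne => Or.inl (SimpleGraph.deleteEdges_adj.2 ⟨hxy, by simpa using hne⟩))
    rw [hP] at hxy
    have := lt_of_mobius_adj hxz
    omega
  refine h1.replace_edge (hPr 1 le_rfl) (fun x y z hxy hxz => ?_) (fun x y hxy => ?_)
    (fun x y hxy hne => ?_)
  · rw [hP] at hxy
    rcases hxz with hxz | hxz
    · have := lt_of_mobius_adj (SimpleGraph.deleteEdges_adj.1 hxz).1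
      omega
    · rw [hP] at hxz
      omega
  · rw [hP] at hxy
    rw [mobius_adj]
    unfold MobiusRel
    rcases hxy.1 with (h | h) | (h | h) | (h | h) <;> omega
  · rw [mobius_adj]
    rcases hxy with hxy | hxy
    · obtain ⟨h1, h2⟩ := SimpleGraph.deleteEdges_adj.1 hxy
      simp only [Set.mem_singleton_iff, Sym2.eq_iff] at h2
      simp only [ne_eq, Sym2.eq_iff] at hne
      exact h1.imp (fun h => h.succ (by omega) (by omega)) (fun h => h.succ (by omega) (by omega))
    · rw [hP] at hxy
      unfold MobiusRel
      rcases hxy.1 with (h | h) | (h | h) | (h | h) <;> omega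

/-- Move every rung of the ladder to the next place. -/
def rotate (k x : ℕ) : ℕ :=
  if x + 5 < 5 * k then x + 5 else
    -- Because of the twist, the last block of five returns as the first with its two sides
    -- exchanged.
    if x % 5 = 0 then 1 else if x % 5 = 1 then 0 else if x % 5 = 2 then 2 else
      if x % 5 = 3 then 4 else 3

/-- The inverse of `rotate` on the vertices of the ladder. -/
def unrotate (k x : ℕ) : ℕ :=
  if 5 ≤ x then x - 5 else 5 * (k - 1) +
    if x = 0 then 1 else if x = 1 then 0 else if x = 2 then 2 else if x = 3 then 4 else 3

lemma rotate_lt {k x : ℕ} (hk : 1 ≤ k) : rotate k x < 5 * k := by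
  unfold rotate; split_ifs <;> omega

lemma unrotate_rotate {k x : ℕ} (hx : x < 5 * k) : unrotate k (rotate k x) = x := by
  unfold rotate; split_ifs <;> simp only [unrotate] <;> grind

lemma rotate_unrotate {k x : ℕ} (hx : x < 5 * k) : rotate k (unrotate k x) = x := by
  unfold unrotate; split_ifs <;> unfold rotate <;> split_ifs <;> omega

lemma mobius_adj_unrotate {k x y : ℕ} (hk : 2 ≤ k) (h : (mobius k).Adj x y) :
    (mobius k).Adj (unrotate k x) (unrotate k y) := by
  have key : ∀ x y, MobiusRel k x y → MobiusRel k (unrotate k x) (unrotate k y) := by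
    intro x y h
    unfold MobiusRel at *
    unfold unrotate
    split_ifs <;> omega
  exact h.imp (key x y) (key y x)

lemma DoublyJoined.of_rotate {k : ℕ} (hk : 2 ≤ k) {S : Finset ℕ} (hS : S ⊆ Finset.range (5 * k))
    (h : DoublyJoined (mobius k) (S.image (rotate k))) : DoublyJoined (mobius k) S := by
  have := h.map (unrotate k) (fun x y hxy => mobius_adj_unrotate hk hxy)
    (fun x y x' y' hxy hxy' he => by
      rw [← rotate_unrotate (lt_of_mobius_adj hxy), he, rotate_unrotate (lt_of_mobius_adj hxy')])
  rwa [Finset.image_image, Finset.image_congr (g := id), Finset.image_id] at this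
  intro x hx
  exact unrotate_rotate (by simpa using hS hx)

/-- The edges of `mobius 3`. -/
def mobiusThreeEdges : List (ℕ × ℕ) :=
  [(0, 2), (1, 2), (0, 3), (1, 4), (3, 5), (4, 6), (5, 7), (6, 7), (5, 8), (6, 9), (8, 10), (9, 11),
    (10, 12), (11, 12), (10, 13), (11, 14), (13, 1), (14, 0)]

/-- This ladder is the subdivision of K₃,₃; each of its 455 triples is served by one of the masks.
-/
lemma allJoined_mobius_three : allJoined (mobiusThreeEdges.map fun e => edgeCode e.1 e.2) 15
    [24751, 13526, 10208, 16599, 9518, 1005, 29711, 26025, 8446, 9720, 17673, 58, 16633, 13654, 93,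
      29791, 599, 24623, 16449, 14329, 16447, 1024] = true := by
  decide +kernel

lemma doublyJoined_mobius {k : ℕ} (hk : 3 ≤ k) : ∀ S ⊆ Finset.range (5 * k), S.card = 3 →
    DoublyJoined (mobius k) S := by
  induction k, hk using Nat.le_induction with
  | base =>
    intro S hS hcard
    refine doublyJoined_of_allJoined allJoined_mobius_three (fun x y => lt_of_mobius_adj)
      ?_ hS hcard
    simp [mobiusThreeEdges, mobius_adj, MobiusRel]
  | succ k hk ih =>
    -- Here `i` is the number of rotations that bring the free block `m` to the last place, where
    -- the remaining vertices are those of the shorter ladder.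
    have key : ∀ i m, m + i = k → ∀ S ⊆ Finset.range (5 * (k + 1)), S.card = 3 →
        (∀ x ∈ S, x / 5 ≠ m) → DoublyJoined (mobius (k + 1)) S := by
      intro i
      induction i with
      | zero =>
        rintro m rfl S hS hcard hfree
        refine (ih S (fun x hx => ?_) hcard).mobius_succ (by omega)
        have h1 := hfree x hx
        have h2 := hS hx
        simp only [Finset.mem_range] at h2 ⊢
        omega
      | succ i ihi =>
        intro m hm S hS hcard hfree
        refine DoublyJoined.of_rotate (by omega) hS (ihi (m + 1) (by omega) _ ?_ ?_ ?_)
        · intro x hx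
          obtain ⟨y, hy, rfl⟩ := Finset.mem_image.1 hx
          simpa using rotate_lt (by omega)
        · rw [Finset.card_image_of_injOn, hcard]
          intro x hx y hy hxy
          rw [← unrotate_rotate (Finset.mem_range.1 (hS hx)), hxy,
            unrotate_rotate (Finset.mem_range.1 (hS hy))]
        · intro x hx
          obtain ⟨y, hy, rfl⟩ := Finset.mem_image.1 hx
          have := hfree y hy
          have := hS hy
          simp only [Finset.mem_range] at this
          unfold rotate
          split_ifs <;> omega
    intro S hS hcard
    -- Three vertices meet at most three of the `k + 1 ≥ 4` blocks.
    obtain ⟨m, hm, hfree⟩ : ∃ m ∈ Finset.range (k + 1), m ∉ S.image (· / 5) := by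
      refine Finset.exists_mem_notMem_of_card_lt_card (lt_of_le_of_lt Finset.card_image_le ?_)
      simp
      omega
    simp only [Finset.mem_range] at hm
    refine key (k - m) m (by omega) S hS hcard fun x hx he => hfree ?_
    exact Finset.mem_image.2 ⟨x, hx, he⟩

/-! ### Explicit graphs of order at most 10. -/

/-- The graph on `ℕ` with the listed edges. -/
def ofEdgeList (E : List (ℕ × ℕ)) : SimpleGraph ℕ where
  Adj x y := x ≠ y ∧ ((x, y) ∈ E ∨ (y, x) ∈ E)
  symm := ⟨fun _ _ h => ⟨h.1.symm, h.2.symm⟩⟩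
  loopless := ⟨fun _ h => h.1 rfl⟩

lemma realizes_ofEdgeList {E : List (ℕ × ℕ)} {n : ℕ} {masks : List ℕ} (hnodup : E.Nodup)
    (hlt : ∀ e ∈ E, e.1 < e.2 ∧ e.2 < n)
    (h : allJoined (E.map fun e => edgeCode e.1 e.2) n masks = true) :
    Realizes (ofEdgeList E) (Finset.range n) E.length := by
  have hn : ∀ x y, (ofEdgeList E).Adj x y → x < n := by
    rintro x y ⟨-, h | h⟩
    · have := hlt _ h
      dsimp only at this
      omega
    · exact (hlt _ h).2
  refine ⟨fun x y hxy => Finset.mem_range.2 (hn x y hxy), ?_, fun S hS hcard => ?_⟩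
  · have heq : (ofEdgeList E).edgeSet = (fun e : ℕ × ℕ => s(e.1, e.2)) '' (E.toFinset : Set _) := by
      ext e
      induction e with
      | _ x y =>
        simp only [SimpleGraph.mem_edgeSet, Set.mem_image, Finset.mem_coe, List.mem_toFinset,
          Prod.exists]
        constructor
        · rintro ⟨-, h | h⟩
          · exact ⟨x, y, h, rfl⟩
          · exact ⟨y, x, h, Sym2.eq_swap⟩
        · rintro ⟨a, b, hab, he⟩
          have hne : a ≠ b := (hlt _ hab).1.ne
          rcases Sym2.eq_iff.1 he with ⟨rfl, rfl⟩ | ⟨rfl, rfl⟩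
          · exact ⟨hne, Or.inl hab⟩
          · exact ⟨hne.symm, Or.inr hab⟩
    rw [heq, Set.InjOn.ncard_image, Set.ncard_coe_finset, List.toFinset_card_of_nodup hnodup]
    rintro ⟨a, b⟩ h1 ⟨c, d⟩ h2 he
    have h3 := (hlt _ (List.mem_toFinset.1 h1)).1
    have h4 := (hlt _ (List.mem_toFinset.1 h2)).1
    dsimp only at h3 h4
    rcases Sym2.eq_iff.1 he with ⟨h5, h6⟩ | ⟨h5, h6⟩
    · exact Prod.ext h5 h6
    · dsimp only at h5 h6
      omega
  · exact doublyJoined_of_allJoined h hn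
      (fun e he => ⟨(hlt e he).1.ne, Or.inl he⟩) hS hcard

/-- A connected graph on `Fin n` with `κ₃ = 2` and `m` edges exists. -/
def HasGraph (n m : ℕ) : Prop :=
  ∃ G : SimpleGraph (Fin n), G.Connected ∧ genConnectivity 3 G = 2 ∧ G.edgeSet.ncard = m

lemma hasGraph_four : HasGraph 4 5 :=
  (realizes_ofEdgeList (E := [(0, 1), (0, 2), (0, 3), (1, 2), (1, 3)]) (n := 4) (masks := [1])
    (by decide) (by decide) (by decide +kernel)).exists_graph (by simp) (by simp) (by simp)

/-- This is K₂,₃, a triple edge with every strand subdivided. -/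
lemma hasGraph_five : HasGraph 5 6 :=
  (realizes_ofEdgeList (E := [(0, 2), (0, 3), (0, 4), (1, 2), (1, 3), (1, 4)]) (n := 5)
    (masks := [5, 6, 9]) (by decide) (by decide) (by decide +kernel)).exists_graph
    (by simp) (by simp) (by simp)

lemma hasGraph_six : HasGraph 6 8 :=
  (realizes_ofEdgeList
    (E := [(0, 1), (0, 3), (0, 4), (1, 3), (1, 5), (2, 3), (2, 4), (2, 5)]) (n := 6)
    (masks := [12, 5, 1, 4]) (by decide) (by decide) (by decide +kernel)).exists_graph
    (by simp) (by simp) (by simp)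

lemma hasGraph_seven : HasGraph 7 9 :=
  (realizes_ofEdgeList
    (E := [(0, 1), (0, 3), (0, 4), (1, 5), (1, 6), (2, 3), (2, 4), (2, 5), (3, 6)]) (n := 7)
    (masks := [19, 35, 1, 2, 4]) (by decide) (by decide) (by decide +kernel)).exists_graph
    (by simp) (by simp) (by simp)

lemma hasGraph_eight : HasGraph 8 10 :=
  (realizes_ofEdgeList
    (E := [(0, 1), (0, 4), (0, 7), (1, 5), (1, 6), (2, 3), (2, 4), (2, 5), (3, 6), (3, 7)]) (n := 8)
    (masks := [83, 92, 21, 38, 1, 2, 4, 8]) (by decide) (by decide)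
    (by decide +kernel)).exists_graph (by simp) (by simp) (by simp)

lemma hasGraph_nine : HasGraph 9 12 :=
  (realizes_ofEdgeList
    (E := [(0, 2), (0, 3), (0, 6), (1, 2), (1, 4), (1, 8), (2, 7), (3, 5), (4, 6), (5, 7), (5, 8),
      (6, 7)]) (n := 9) (masks := [15, 172, 212, 229, 40]) (by decide) (by decide)
    (by decide +kernel)).exists_graph (by simp) (by simp) (by simp)

lemma hasGraph_ten : HasGraph 10 13 :=
  (realizes_ofEdgeList
    (E := [(0, 2), (0, 3), (0, 9), (1, 2), (1, 4), (1, 8), (2, 7), (3, 5), (4, 6), (5, 7), (5, 8),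
      (6, 7), (6, 9)]) (n := 10) (masks := [31, 248, 44, 84, 3, 133, 134]) (by decide) (by decide)
    (by decide +kernel)).exists_graph (by simp) (by simp) (by simp)

/-! ### All orders from 11 on. -/

lemma realizes_mobius {k : ℕ} (hk : 3 ≤ k) :
    Realizes (mobius k) (Finset.range (5 * k)) (6 * k) :=
  ⟨fun _ _ h => Finset.mem_range.2 (lt_of_mobius_adj h), ncard_edgeSet_mobius k,
    doublyJoined_mobius hk⟩

/-- Up to four subdividing vertices of the ladder can be suppressed. -/
lemma exists_realizes_of_le_four {k j : ℕ} (hk : 3 ≤ k) (hj : j ≤ 4) :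
    ∃ (G : SimpleGraph ℕ) (A : Finset ℕ), Realizes G A (6 * k - j) ∧ A.card = 5 * k - j := by
  have h0 := realizes_mobius hk
  -- The middles of three rungs and of one side edge are suppressed; their pairs of hubs differ, so
  -- each new edge was absent before.
  have hN : ∀ w u v y : ℕ, (w = 2 ∧ u = 0 ∧ v = 1) ∨ (w = 7 ∧ u = 5 ∧ v = 6) ∨
      (w = 12 ∧ u = 10 ∧ v = 11) ∨ (w = 3 ∧ u = 0 ∧ v = 5) →
      ((mobius k).Adj w y ↔ y = u ∨ y = v) := by
    intro w u v y h
    rw [mobius_adj]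
    unfold MobiusRel
    rcases h with ⟨rfl, rfl, rfl⟩ | ⟨rfl, rfl, rfl⟩ | ⟨rfl, rfl, rfl⟩ | ⟨rfl, rfl, rfl⟩ <;> omega
  have hH : ∀ x y, x % 5 < 2 → y % 5 < 2 → ¬ (mobius k).Adj x y := by
    intro x y hx hy
    rw [mobius_adj]
    unfold MobiusRel
    omega
  have h1 := Realizes.suppress (m := 6 * k - 1) (u := 0) (v := 1) (w := 2)
    (by rwa [Nat.sub_add_cancel (by omega)]) (by simp) (fun y => hN _ _ _ y (by simp))
    (hH _ _ (by simp) (by simp))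
  have h2 := Realizes.suppress (m := 6 * k - 2) (u := 5) (v := 6) (w := 7)
    (by rwa [show 6 * k - 2 + 1 = 6 * k - 1 by omega]) (by simp)
    (fun y => by
      have := hN 7 5 6 y (by simp)
      simp only [suppress_adj, Sym2.eq_iff, this]
      omega)
    (by simp [suppress_adj, hH])
  have h3 := Realizes.suppress (m := 6 * k - 3) (u := 10) (v := 11) (w := 12)
    (by rwa [show 6 * k - 3 + 1 = 6 * k - 2 by omega]) (by simp)
    (fun y => by
      have := hN 12 10 11 y (by simp)
      simp only [suppress_adj, Sym2.eq_iff, this]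
      omega)
    (by simp [suppress_adj, hH])
  have h4 := Realizes.suppress (m := 6 * k - 4) (u := 0) (v := 5) (w := 3)
    (by rwa [show 6 * k - 4 + 1 = 6 * k - 3 by omega]) (by simp)
    (fun y => by
      have := hN 3 0 5 y (by simp)
      simp only [suppress_adj, Sym2.eq_iff, this]
      omega)
    (by simp [suppress_adj, hH])
  have hcard : ∀ (A : Finset ℕ) (c x : ℕ), A.card = c → x ∈ A → (A.erase x).card = c - 1 := by
    rintro A c x rfl hx
    exact Finset.card_erase_of_mem hx
  have c0 : (Finset.range (5 * k)).card = 5 * k := Finset.card_range _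
  have c1 := hcard _ _ 2 c0 (by simp; omega)
  have c2 := hcard _ _ 7 c1 (by simp; omega)
  have c3 := hcard _ _ 12 c2 (by simp; omega)
  have c4 := hcard _ _ 3 c3 (by simp; omega)
  interval_cases j
  · exact ⟨_, _, h0, c0⟩
  · exact ⟨_, _, h1, c1⟩
  · exact ⟨_, _, h2, by omega⟩
  · exact ⟨_, _, h3, by omega⟩
  · exact ⟨_, _, h4, by omega⟩

/-- With k = ⌈n/5⌉ and j = 5k - n ≤ 4, the order n ≥ 11 ensures the three rungs that the ladder
needs. -/
lemma hasGraph_of_eleven_le {n : ℕ} (hn : 11 ≤ n) : HasGraph n ((6 * n + 4) / 5) := by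
  obtain ⟨k, j, hk, hj, hkj⟩ : ∃ k j, 3 ≤ k ∧ j ≤ 4 ∧ n + j = 5 * k :=
    ⟨(n + 4) / 5, 5 * ((n + 4) / 5) - n, by omega, by omega, by omega⟩
  obtain ⟨G, A, h, hA⟩ := exists_realizes_of_le_four hk hj
  rw [show (6 * n + 4) / 5 = 6 * k - j by omega]
  exact h.exists_graph (by omega) (by omega) (by omega)

lemma ceil_six_fifths_mul (n : ℕ) : ⌈(6 / 5 : ℚ) * (n : ℚ)⌉₊ = (6 * n + 4) / 5 := by
  refine eq_of_forall_ge_iff fun m => ?_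
  rw [Nat.ceil_le]
  have h : (6 / 5 : ℚ) * n ≤ m ↔ ((6 * n : ℕ) : ℚ) ≤ ((5 * m : ℕ) : ℚ) := by
    push_cast
    constructor <;> intro h <;> linarith
  rw [h, Nat.cast_le]
  omega

end GenConn

theorem theorem1 :
    -- the lower bound
    (∀ (V : Type*) [Fintype V] (G : SimpleGraph V), GenConn.genConnectivity 3 G = 2 →
      ⌈(6 / 5 : ℚ) * (Fintype.card V : ℚ)⌉₊ ≤ G.edgeSet.ncard) ∧
    -- it is attained for every order `n ≥ 4` other than `9` and `10`
    (∀ n : ℕ, 4 ≤ n → n ≠ 9 → n ≠ 10 →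
      ∃ G : SimpleGraph (Fin n), G.Connected ∧ GenConn.genConnectivity 3 G = 2 ∧
        G.edgeSet.ncard = ⌈(6 / 5 : ℚ) * (n : ℚ)⌉₊) ∧
    -- for the orders `9` and `10` the minimum is larger by one
    (∀ (V : Type*) [Fintype V] (G : SimpleGraph V),
      (Fintype.card V = 9 ∨ Fintype.card V = 10) → GenConn.genConnectivity 3 G = 2 →
      ⌈(6 / 5 : ℚ) * (Fintype.card V : ℚ)⌉₊ + 1 ≤ G.edgeSet.ncard) ∧
    (∀ n : ℕ, (n = 9 ∨ n = 10) →
      ∃ G : SimpleGraph (Fin n), G.Connected ∧ GenConn.genConnectivity 3 G = 2 ∧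
        G.edgeSet.ncard = ⌈(6 / 5 : ℚ) * (n : ℚ)⌉₊ + 1) := by
  simp only [GenConn.ceil_six_fifths_mul]
  refine ⟨fun V _ G h => ?_, fun n hn h9 h10 => ?_, fun V _ G hn h => ?_, fun n hn => ?_⟩
  · have := GenConn.six_mul_card_le h
    omega
  · by_cases hlarge : 11 ≤ n
    · exact GenConn.hasGraph_of_eleven_le hlarge
    · obtain rfl | rfl | rfl | rfl | rfl : n = 4 ∨ n = 5 ∨ n = 6 ∨ n = 7 ∨ n = 8 := by omega
      · exact GenConn.hasGraph_four
      · exact GenConn.hasGraph_five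
      · exact GenConn.hasGraph_six
      · exact GenConn.hasGraph_seven
      · exact GenConn.hasGraph_eight
  · exact GenConn.lt_ncard_edgeSet_of_card_eq_nine_or_ten hn h
  · rcases hn with rfl | rfl
    · exact GenConn.hasGraph_nine
    · exact GenConn.hasGraph_ten
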